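/- **q-Maxwell plane waves.** Let $q\in\mathbb R$, $q\neq 0,-1$. Repeated indices are summed. Spinor indices run over $\{1,2\}$, space-time indices $a=(AA')$ over $1=(11),2=(12),3=(21),4=(22)$. *Data.* Let $R$ be the standard $SU_q(2)$ R-matrix: $R^{11}_{11}=R^{22}_{22}=q$, $R^{12}_{12}=R^{21}_{21}=1$, $R^{12}_{21}=q-q^{-1}$, other entries $0$; $\widetilde R=((R^{t_2})^{-1})^{t_2}$, with $t_2$ the transposition in the second factor. Put $$\mathbf R_M{}^{ab}_{cd}=(R^{-1})^{LC}_{BI}R^{B'I}_{JA}R^{A'J}_{KD'}\widetilde R^{KD}_{C'L},\qquad \mathbf R_L{}^{ab}_{cd}=R^{CI}_{JB}R^{B'J}_{KA}R^{A'K}_{LD'}\widetilde R^{LD}_{C'I}.$$ With a fixed complex square root $q^{1/2}$ and $\varepsilon_{12}=q^{-1/2}$, $\varepsilon_{21}=-q^{1/2}$, $\varepsilon^{AB}=-\varepsilon_{BA}$ (other components $0$), the q-metric is $g^{ab}=\varepsilon_{AC}R^{A'C}_{DB}\varepsilon^{DB'}$, and $g_{ab}$ is its inverse in the sense $g^{ak}g_{ab}=\delta^k_b$.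 Indices are raised by $T^{b}=T_a g^{ab}$, i.e. lowered by $T_a=g_{ab}T^b$. Let $\varepsilon_{abcd}$ be the complex tensor which is totally q-antisymmetric, i.e. $T_{\ldots ab\ldots}=-T_{\ldots cd\ldots}\mathbf R_L{}^{dc}_{ab}$ in any two adjacent indices, with $\varepsilon_{1234}=1$, and $\varepsilon^{abcd}=\varepsilon_{ijkl}g^{ia}g^{jb}g^{kc}g^{ld}$. Let $n_1=n_3=2(1+q^2+q^4)$, $n_2=(1+q^2)^2$, $n_0=n_4=2q^{-2}(1+q^2+q^4)(1+q^2)^2$. The q-antisymmetrisers are $\mathcal A_{\{0\}}=1$, $$\mathcal A_{\{1\}}{}^{a}_{h}=-\tfrac1{n_1}\varepsilon^{dcba}\varepsilon_{bcdh},\quad \mathcal A_{\{2\}}{}^{ab}_{gh}=\tfrac1{n_2}\varepsilon^{dcba}\varepsilon_{cdgh},\quad \mathcal A_{\{3\}}{}^{abc}_{fgh}=-\tfrac1{n_3}\varepsilon^{dcba}\varepsilon_{dfgh},\quad \mathcal A_{\{4\}}{}^{abcd}_{efgh}=\tfrac1{n_4}\varepsilon^{dcba}\varepsilon_{efgh},$$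 and $\mathcal A_{\{k\}}=0$ for $k>4$; one writes $T_{[a_1\ldots a_k]}=T_{c_1\ldots c_k}\mathcal A_{\{k\}}{}^{c_1\ldots c_k}_{a_1\ldots a_k}$. *Algebras.* q-Minkowski space $M_q$ is the unital $\mathbb C$-algebra with generators $x_a$ and relations $x_ax_b=x_dx_c\,\mathbf R_M{}^{cd}_{ab}$. The braided derivatives $\partial^a:M_q\to M_q$ are the linear maps with $\partial^a1=0$ and $\partial^a(x_bf)=\delta^a_bf+x_m\mathbf R_L{}^{ma}_{bk}\,\partial^kf$. The q-light cone $P_0$ has generators $p^a$ and relations $p^ap^b=\mathbf R_M{}^{ab}_{cd}\,p^dp^c$, $g_{ab}p^ap^b=0$. Let $A_a$ be the generators of a second copy of $M_q$. The braided tensor product $P_0\underline\otimes M_q$ is generated by $P_0$ and this copy, with cross relations $p^nA_b=\mathbf R_L{}^{mn}_{ba}A_mp^a$, and $Y$ is its quotient by the relation $p^cA_c=0$. *Forms.* Let $\Lambda_p$ be the span of the vectors $\mathbf e_{a_1\ldots a_p}=dx_{b_1}\otimes\cdots\otimes dx_{b_p}\,\mathcal A_{\{p\}}{}^{b_1\ldots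 b_p}_{a_1\ldots a_p}$ in $(\mathbb C^4)^{\otimes p}$. Let $\mathcal S=\prod_{n\ge0}(M_q)_n\otimes Y$ be the space of formal power series in $M_q\otimes Y$, where $(M_q)_n$ is the part of degree $n$; the $\partial^a$ act on the factor $M_q$. A $Y$-indexed $p$-form is a linear map $\mathbf w:\Lambda_p\to\mathcal S$. Define $$d\mathbf w(\mathbf e_{a_1\ldots a_{p+1}})=\partial_{[a_1}w_{a_2\ldots a_{p+1}]},\qquad {}^*\mathbf w(\mathbf e_{a_1\ldots a_{4-p}})=n_p^{-1/2}\,\varepsilon_{a_1\ldots a_{4-p}b_1\ldots b_p}g^{b_1c_p}\cdots g^{b_pc_1}w_{[c_1\ldots c_p]},\qquad \delta={}^*d\,{}^*,$$ where $w_{c_1\ldots c_p}$ is any tensor with $w_{[c_1\ldots c_p]}=\mathbf w(\mathbf e_{c_1\ldots c_p})$. Finally let $$\exp(ix.p)=\sum_{n\ge0}\frac{i^n}{[n]!}\,x_{a_1}\cdots x_{a_n}\otimes p^{a_n}\cdots p^{a_1},\qquad [n]=1+q+\cdots+q^{n-1}.$$ **Proposition.** There is a $Y$-indexed 1-form $\mathbf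 A$ with $\mathbf A(\mathbf e_z)=\exp(ix.p)\otimes A_z$ for all $z$. It solves the q-Maxwell equation $\delta d\mathbf A=0$ and satisfies the q-Lorentz gauge condition $\delta\mathbf A=0$. -/

import Mathlib

noncomputable section

open scoped TensorProduct

namespace QMinkowski

/-! ### The R-matrices

Spinor indices run over `Fin 2`.  A space-time index `a : Fin 4` stands for the multi-index
`(A A')`, in the order `11, 12, 21, 22`.  For a matrix `X`, the value `X i j k l` is `X^{ij}_{kl}`. -/

/-- The standard `SU_q(2)` R-matrix. -/
def rMat (q : ℂ) (i j k l : Fin 2) : ℂ :=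
  if i = k ∧ j = l then (if i = j then q else 1)
  else if i = 0 ∧ j = 1 ∧ k = 1 ∧ l = 0 then q - q⁻¹ else 0

/-- The inverse `R⁻¹`, see `rMat_mul_rInv`. -/
def rInv (q : ℂ) (i j k l : Fin 2) : ℂ :=
  if i = k ∧ j = l then (if i = j then q⁻¹ else 1)
  else if i = 0 ∧ j = 1 ∧ k = 1 ∧ l = 0 then q⁻¹ - q else 0

/-- `((R^{t₂})⁻¹)^{t₂}`, where `t₂` transposes the second tensor factor, see `rMat_mul_rTilde`. -/
def rTilde (q : ℂ) (i j k l : Fin 2) : ℂ :=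
  if i = k ∧ j = l then (if i = j then q⁻¹ else 1)
  else if i = 0 ∧ j = 1 ∧ k = 1 ∧ l = 0 then -(q⁻¹ ^ 2 * (q - q⁻¹)) else 0

theorem rMat_mul_rInv {q : ℂ} (hq : q ≠ 0) (i j k l : Fin 2) :
    ∑ a, ∑ b, rMat q i j a b * rInv q a b k l = if i = k ∧ j = l then 1 else 0 := by
  fin_cases i <;> fin_cases j <;> fin_cases k <;> fin_cases l <;>
    simp [rMat, rInv, Fin.sum_univ_two, hq]

/-- `R^{t₂} (rTilde)^{t₂} = 1`. -/
theorem rMat_mul_rTilde {q : ℂ} (hq : q ≠ 0) (i j k l : Fin 2) :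
    ∑ a, ∑ b, rMat q i b a j * rTilde q a l k b = if i = k ∧ j = l then 1 else 0 := by
  fin_cases i <;> fin_cases j <;> fin_cases k <;> fin_cases l <;>
    simp [rMat, rTilde, Fin.sum_univ_two, hq]
  field_simp
  ring

/-- The index `A` of `a = (A A')`. -/
def fstIdx : Fin 4 → Fin 2 := ![0, 0, 1, 1]

/-- The index `A'` of `a = (A A')`. -/
def sndIdx : Fin 4 → Fin 2 := ![0, 1, 0, 1]

/-- `R_M^{ab}_{cd} = R⁻¹^{LC}_{BI} R^{B'I}_{JA} R^{A'J}_{KD'} R̃^{KD}_{C'L}`. -/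
def rM (q : ℝ) (a b c d : Fin 4) : ℂ :=
  ∑ I : Fin 2, ∑ J : Fin 2, ∑ K : Fin 2, ∑ L : Fin 2,
    rInv q L (fstIdx c) (fstIdx b) I * rMat q (sndIdx b) I J (fstIdx a) *
      rMat q (sndIdx a) J K (sndIdx d) * rTilde q K (fstIdx d) (sndIdx c) L

/-- `R_L^{ab}_{cd} = R^{CI}_{JB} R^{B'J}_{KA} R^{A'K}_{LD'} R̃^{LD}_{C'I}`. -/
def rL (q : ℝ) (a b c d : Fin 4) : ℂ :=
  ∑ I : Fin 2, ∑ J : Fin 2, ∑ K : Fin 2, ∑ L : Fin 2,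
    rMat q (fstIdx c) I J (fstIdx b) * rMat q (sndIdx b) J K (fstIdx a) *
      rMat q (sndIdx a) K L (sndIdx d) * rTilde q L (fstIdx d) (sndIdx c) I

/-! ### The q-metric, the q-antisymmetric tensor and the q-antisymmetrisers -/

/-- The spinor metric `ε_{AB}`. -/
def spinLow (q : ℝ) : Matrix (Fin 2) (Fin 2) ℂ :=
  !![0, ((q : ℂ) ^ (1 / 2 : ℂ))⁻¹; -((q : ℂ) ^ (1 / 2 : ℂ)), 0]

/-- The inverse spinor metric `ε^{AB} = -ε_{BA}`. -/
def spinUp (q : ℝ) : Matrix (Fin 2) (Fin 2) ℂ :=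
  !![0, (q : ℂ) ^ (1 / 2 : ℂ); -((q : ℂ) ^ (1 / 2 : ℂ))⁻¹, 0]

/-- `ε^{DB} ε_{DA} = δ^B_A`. -/
theorem spinUp_mul_spinLow {q : ℝ} (hq : q ≠ 0) (A B : Fin 2) :
    ∑ D, spinUp q D B * spinLow q D A = if B = A then 1 else 0 := by
  have h : (q : ℂ) ^ (1 / 2 : ℂ) ≠ 0 := by
    rw [Ne, Complex.cpow_eq_zero_iff]; simp [hq]
  fin_cases A <;> fin_cases B <;> simp [spinUp, spinLow, Fin.sum_univ_two] <;> field_simp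

/-- The q-metric `g^{ab} = ε_{AC} R^{A'C}_{DB} ε^{DB'}`. It is normalised so that the
q-antisymmetrisers below are projectors. -/
def gUp (q : ℝ) (a b : Fin 4) : ℂ :=
  ∑ C : Fin 2, ∑ D : Fin 2,
    spinLow q (fstIdx a) C * rMat q (sndIdx a) C D (fstIdx b) * spinUp q D (sndIdx b)

/-- The inverse `g_{ab}` of the q-metric, see `gUp_mul_gLow`. -/
def gLow (q : ℝ) : Fin 4 → Fin 4 → ℂ :=
  ![![0, 0, 0, 1], ![0, 0, -1, 0], ![0, -(q : ℂ)⁻¹ ^ 2, 0, 0], ![1, 0, 0, 1 - (q : ℂ)⁻¹ ^ 2]]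

theorem gUp_eq {q : ℝ} (hq : q ≠ 0) (a b : Fin 4) :
    gUp q a b = (![![-(1 - (q : ℂ)⁻¹ ^ 2), 0, 0, 1], ![0, 0, -1, 0], ![0, -(q : ℂ) ^ 2, 0, 0],
      ![1, 0, 0, 0]] : Fin 4 → Fin 4 → ℂ) a b := by
  have hq' : (q : ℂ) ≠ 0 := by exact_mod_cast hq
  have h : ((q : ℂ) ^ (1 / 2 : ℂ)) ^ 2 = q := by
    rw [← Complex.cpow_nat_mul]; norm_num
  have hs : (q : ℂ) ^ (1 / 2 : ℂ) ≠ 0 := by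
    rw [Ne, Complex.cpow_eq_zero_iff]; simp [hq]
  simp only [gUp, spinLow, spinUp]
  generalize (q : ℂ) ^ (1 / 2 : ℂ) = s at *
  rw [← h] at hq' ⊢
  fin_cases a <;> fin_cases b <;>
    simp [fstIdx, sndIdx, rMat, Fin.sum_univ_two] <;> field_simp <;> ring

/-- `g^{ak} g_{ab} = δ^k_b`. -/
theorem gUp_mul_gLow {q : ℝ} (hq : q ≠ 0) (k b : Fin 4) :
    ∑ a, gUp q a k * gLow q a b = if k = b then 1 else 0 := by
  have hq' : (q : ℂ) ≠ 0 := by exact_mod_cast hq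
  simp only [gUp_eq hq]
  fin_cases k <;> fin_cases b <;> simp [gLow, Fin.sum_univ_four, hq]

/-- The totally q-antisymmetric tensor `ε_{abcd}`, normalised by `ε_{1234} = 1`. -/
def epsLow (q : ℝ) : Fin 4 → Fin 4 → Fin 4 → Fin 4 → ℂ
  | 0, 1, 2, 3 => 1
  | 0, 1, 3, 2 => -(q : ℂ)⁻¹ ^ 2
  | 0, 2, 1, 3 => -1
  | 0, 2, 3, 1 => (q : ℂ) ^ 2
  | 0, 3, 0, 3 => 1 - (q : ℂ) ^ 2
  | 0, 3, 1, 2 => 1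
  | 0, 3, 2, 1 => -1
  | 0, 3, 3, 3 => 1 - (q : ℂ)⁻¹ ^ 2
  | 1, 0, 2, 3 => -1
  | 1, 0, 3, 2 => (q : ℂ)⁻¹ ^ 2
  | 1, 2, 0, 3 => 1
  | 1, 2, 3, 0 => -1
  | 1, 3, 0, 2 => -(q : ℂ)⁻¹ ^ 2
  | 1, 3, 2, 0 => (q : ℂ)⁻¹ ^ 2
  | 1, 3, 2, 3 => (q : ℂ)⁻¹ ^ 2 - 1
  | 2, 0, 1, 3 => 1
  | 2, 0, 3, 1 => -(q : ℂ) ^ 2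
  | 2, 1, 0, 3 => -1
  | 2, 1, 3, 0 => 1
  | 2, 3, 0, 1 => (q : ℂ) ^ 2
  | 2, 3, 1, 0 => -(q : ℂ) ^ 2
  | 2, 3, 1, 3 => 1 - (q : ℂ) ^ 2
  | 3, 0, 1, 2 => -1
  | 3, 0, 2, 1 => 1
  | 3, 0, 3, 0 => (q : ℂ) ^ 2 - 1
  | 3, 0, 3, 3 => (q : ℂ)⁻¹ ^ 2 - 1
  | 3, 1, 0, 2 => 1
  | 3, 1, 2, 0 => -1
  | 3, 1, 3, 2 => 1 - (q : ℂ)⁻¹ ^ 2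
  | 3, 2, 0, 1 => -1
  | 3, 2, 1, 0 => 1
  | 3, 2, 3, 1 => (q : ℂ) ^ 2 - 1
  | 3, 3, 0, 3 => 1 - (q : ℂ)⁻¹ ^ 2
  | 3, 3, 3, 0 => (q : ℂ)⁻¹ ^ 2 - 1
  | _, _, _, _ => 0

/-- `ε^{abcd} = ε_{ijkl} g^{ia} g^{jb} g^{kc} g^{ld}`. -/
def epsUp (q : ℝ) (a b c d : Fin 4) : ℂ :=
  ∑ i, ∑ j, ∑ k, ∑ l, epsLow q i j k l * gUp q i a * gUp q j b * gUp q k c * gUp q l d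

/-- The normalisation factors `n_p`, with `n_0 = n_4`. -/
def nFactor (q : ℝ) : ℕ → ℝ
  | 1 => 2 * (1 + q ^ 2 + q ^ 4)
  | 2 => (1 + q ^ 2) * (1 + q ^ 2)
  | 3 => 2 * (1 + q ^ 2 + q ^ 4)
  | _ => q⁻¹ ^ 2 * (2 * (1 + q ^ 2 + q ^ 4) * (1 + q ^ 2) * (1 + q ^ 2))

/-- The q-antisymmetrisers: `antisym q k c a = A_{k}^{c₁…c_k}_{a₁…a_k}`. -/
def antisym (q : ℝ) : (k : ℕ) → (Fin k → Fin 4) → (Fin k → Fin 4) → ℂ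
  | 0, _, _ => 1
  | 1, u, l => -(nFactor q 1 : ℂ)⁻¹ *
      ∑ b, ∑ c, ∑ d, epsUp q d c b (u 0) * epsLow q b c d (l 0)
  | 2, u, l => (nFactor q 2 : ℂ)⁻¹ *
      ∑ c, ∑ d, epsUp q d c (u 1) (u 0) * epsLow q c d (l 0) (l 1)
  | 3, u, l => -(nFactor q 3 : ℂ)⁻¹ *
      ∑ d, epsUp q d (u 2) (u 1) (u 0) * epsLow q d (l 0) (l 1) (l 2)
  | 4, u, l => (nFactor q 4 : ℂ)⁻¹ *
      (epsUp q (u 3) (u 2) (u 1) (u 0) * epsLow q (l 0) (l 1) (l 2) (l 3))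
  | _ + 5, _, _ => 0

/-! ### The q-exterior algebra -/

/-- `e_{a₁…a_p} = dx_{b₁} ⊗ … ⊗ dx_{b_p} A^{b₁…b_p}_{a₁…a_p}`, given by its coefficients with
respect to the basis `dx_{b₁} ⊗ … ⊗ dx_{b_p}`. -/
def eVec (q : ℝ) (p : ℕ) (a : Fin p → Fin 4) : (Fin p → Fin 4) → ℂ :=
  fun b => antisym q p b a

/-- The space `Λ_p` spanned by the `e_{a₁…a_p}`. -/
def Lam (q : ℝ) (p : ℕ) : Submodule ℂ ((Fin p → Fin 4) → ℂ) :=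
  Submodule.span ℂ (Set.range (eVec q p))

/-- The element `e_{a₁…a_p}` of `Λ_p`. -/
def e (q : ℝ) {p : ℕ} (a : Fin p → Fin 4) : Lam q p :=
  ⟨eVec q p a, Submodule.subset_span ⟨a, rfl⟩⟩

/-- `p`-forms with values in `N`. -/
abbrev QForm (q : ℝ) (N : Type*) [AddCommMonoid N] [Module ℂ N] (p : ℕ) : Type _ :=
  Lam q p →ₗ[ℂ] N

section Operators

variable (q : ℝ) {N : Type*} [AddCommMonoid N] [Module ℂ N]

/-- The `p`-form `e_{a₁…a_p} ↦ T_{[a₁…a_p]} = T_{b₁…b_p} A^{b₁…b_p}_{a₁…a_p}`. -/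
def ofTensor {p : ℕ} (T : (Fin p → Fin 4) → N) : QForm q N p :=
  (Fintype.linearCombination ℂ T).comp (Lam q p).subtype

theorem ofTensor_e {p : ℕ} (T : (Fin p → Fin 4) → N) (a : Fin p → Fin 4) :
    ofTensor q T (e q a) = ∑ b, antisym q p b a • T b := rfl

/-- `∂_a = g_{ab} ∂^b`, so that `∂^b = ∂_a g^{ab}`. -/
def lower (D : Fin 4 → N →ₗ[ℂ] N) (a : Fin 4) : N →ₗ[ℂ] N := ∑ b, gLow q a b • D b

/-- The q-exterior derivative `dw (e_{a₁…a_{p+1}}) = ∂_{[a₁} w_{a₂…a_{p+1}]}` for operators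
`D a = ∂^a` on the space of values. -/
def extD (D : Fin 4 → N →ₗ[ℂ] N) {p : ℕ} (w : QForm q N p) : QForm q N (p + 1) :=
  ofTensor q fun a => lower q D (a 0) (w (e q (Fin.tail a)))

/-- `n_p^{1/2} H_p^{c₁…c_p}_{a₁…a_{4-p}}
  = ε_{a₁…a_{4-p} b₁…b_p} g^{b₁ c_p} … g^{b_p c₁}`. -/
def hodgeKernel : (p : ℕ) → (Fin p → Fin 4) → (Fin (4 - p) → Fin 4) → ℂ
  | 0, _, (a : Fin 4 → Fin 4) => epsLow q (a 0) (a 1) (a 2) (a 3)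
  | 1, c, (a : Fin 3 → Fin 4) => ∑ i, epsLow q (a 0) (a 1) (a 2) i * gUp q i (c 0)
  | 2, c, (a : Fin 2 → Fin 4) =>
      ∑ i, ∑ j, epsLow q (a 0) (a 1) i j * gUp q i (c 1) * gUp q j (c 0)
  | 3, c, (a : Fin 1 → Fin 4) =>
      ∑ i, ∑ j, ∑ k, epsLow q (a 0) i j k * gUp q i (c 2) * gUp q j (c 1) * gUp q k (c 0)
  | 4, c, _ => ∑ i, ∑ j, ∑ k, ∑ l,
      epsLow q i j k l * gUp q i (c 3) * gUp q j (c 2) * gUp q k (c 1) * gUp q l (c 0)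
  | _ + 5, _, _ => 0

/-- The q-Hodge star `*w (e_{a₁…a_{4-p}}) = w_{[c₁…c_p]} H_p^{c₁…c_p}_{a₁…a_{4-p}}`, where
`w_{[c₁…c_p]} = w (e_{c₁…c_p})`.  The right hand side is q-antisymmetric in the `a`'s, hence it is
not changed by the antisymmetrisation in `ofTensor`. -/
def hodge {p : ℕ} (w : QForm q N p) : QForm q N (4 - p) :=
  ofTensor q fun a =>
    (((Real.sqrt (nFactor q p))⁻¹ : ℝ) : ℂ) • ∑ c, hodgeKernel q p c a • w (e q c)

/-- The q-coderivative `δ = * d *`; it maps `p`-forms to `(p-1)`-forms for `1 ≤ p ≤ 4`. -/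
def coD (D : Fin 4 → N →ₗ[ℂ] N) {p : ℕ} (w : QForm q N p) : QForm q N (4 - (4 - p + 1)) :=
  hodge q (extD q D (hodge q w))

end Operators

/-! ### q-Minkowski space -/

/-- The relations `x_a x_b = x_d x_c R_M^{cd}_{ab}`. -/
inductive MRel (q : ℝ) : FreeAlgebra ℂ (Fin 4) → FreeAlgebra ℂ (Fin 4) → Prop
  | comm (a b : Fin 4) : MRel q (FreeAlgebra.ι ℂ a * FreeAlgebra.ι ℂ b)
      (∑ c, ∑ d, rM q c d a b • (FreeAlgebra.ι ℂ d * FreeAlgebra.ι ℂ c))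

/-- q-Minkowski space `M_q`, the algebra of quantum covectors of `R_M`. -/
abbrev Mq (q : ℝ) : Type := RingQuot (MRel q)

/-- The generators `x_a` of `M_q`. -/
def x (q : ℝ) (a : Fin 4) : Mq q := RingQuot.mkAlgHom ℂ (MRel q) (FreeAlgebra.ι ℂ a)

theorem x_mul_x (q : ℝ) (a b : Fin 4) :
    x q a * x q b = ∑ c, ∑ d, rM q c d a b • (x q d * x q c) := by
  have h := RingQuot.mkAlgHom_rel ℂ (MRel.comm (q := q) a b)
  simpa [x, map_sum] using h

/-! ### R-matrix identities needed for the braided derivatives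

`rowL` and `rowM` write out the contractions `R_{cd}^{ab} G^{cd}` with `u = q²`, `t = q⁻²`. -/

theorem forall4 {P : Fin 4 → Prop} (h0 : P 0) (h1 : P 1) (h2 : P 2) (h3 : P 3) : ∀ i, P i := by
  intro i; fin_cases i <;> assumption


def rowL (u t : ℂ) (G : Fin 4 → Fin 4 → ℂ) : Fin 4 → Fin 4 → ℂ
  | 0, 0 => (u) * G 0 0 + (u - 2 + t) * G 0 3 + (-2 + 3 * t - t ^ 2) * G 1 2 + (1 - t) * G 2 1 + (u - 2 + t) * G 3 0 + (-1 + 2 * t - t ^ 2) * G 3 3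
  | 0, 1 => G 0 1 + (u - 1) * G 1 0 + (-1 + t) * G 1 3
  | 0, 2 => (u) * G 0 2 + (u - 1) * G 2 3 + (u - 2 + t) * G 3 2
  | 0, 3 => G 0 3 + (1 - t) * G 1 2
  | 1, 0 => (u) * G 1 0 + (u - 2 + t) * G 1 3 + (u - 1) * G 3 1
  | 1, 1 => (u) * G 1 1
  | 1, 2 => G 1 2 + (u - 1) * G 3 3
  | 1, 3 => G 1 3
  | 2, 0 => (u - 1) * G 0 2 + G 2 0 + (-1 + t) * G 3 2
  | 2, 1 => (u - 1) * G 0 3 + (u - 2 + t) * G 1 2 + G 2 1 + (u - 1) * G 3 0 + (-1 + t) * G 3 3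
  | 2, 2 => (u) * G 2 2
  | 2, 3 => (u) * G 2 3 + (u - 1) * G 3 2
  | 3, 0 => (1 - t) * G 1 2 + G 3 0
  | 3, 1 => (u - 1) * G 1 3 + (u) * G 3 1
  | 3, 2 => G 3 2
  | 3, 3 => (u) * G 3 3

def rowM (u t : ℂ) (G : Fin 4 → Fin 4 → ℂ) : Fin 4 → Fin 4 → ℂ
  | 0, 0 => G 0 0 + (-1 + t) * G 1 2 + (1 - t) * G 2 1 + (u - 2 + t) * G 3 0 + (-1 + 2 * t - t ^ 2) * G 3 3
  | 0, 1 => (t) * G 0 1 + (1 - t) * G 1 0 + (-t + t ^ 2) * G 1 3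
  | 0, 2 => (u) * G 0 2 + (-u + 1) * G 2 0 + (1 - t) * G 2 3 + (u - 1 - t + t ^ 2) * G 3 2
  | 0, 3 => G 0 3 + (1 - t) * G 1 2 + (-1 + t) * G 2 1 + (-u + 2 - t) * G 3 0 + (1 - 2 * t + t ^ 2) * G 3 3
  | 1, 0 => G 1 0 + (u - 1) * G 3 1
  | 1, 1 => G 1 1
  | 1, 2 => G 1 2 + (-u + 1) * G 3 0 + (1 - t) * G 3 3
  | 1, 3 => G 1 3 + (-u + 1) * G 3 1
  | 2, 0 => G 2 0 + (-1 + t) * G 3 2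
  | 2, 1 => G 2 1 + (u - 1) * G 3 0 + (-1 + t) * G 3 3
  | 2, 2 => G 2 2
  | 2, 3 => G 2 3 + (1 - t) * G 3 2
  | 3, 0 => G 3 0
  | 3, 1 => (u) * G 3 1
  | 3, 2 => (t) * G 3 2
  | 3, 3 => G 3 3


theorem rMat_tab (q : ℂ) :
    rMat q 0 0 0 0 = q ∧ rMat q 0 0 0 1 = 0 ∧ rMat q 0 0 1 0 = 0 ∧ rMat q 0 0 1 1 = 0 ∧ rMat q 0 1 0 0 = 0 ∧ rMat q 0 1 0 1 = 1 ∧ rMat q 0 1 1 0 = q - q⁻¹ ∧ rMat q 0 1 1 1 = 0 ∧ rMat q 1 0 0 0 = 0 ∧ rMat q 1 0 0 1 = 0 ∧ rMat q 1 0 1 0 = 1 ∧ rMat q 1 0 1 1 = 0 ∧ rMat q 1 1 0 0 = 0 ∧ rMat q 1 1 0 1 = 0 ∧ rMat q 1 1 1 0 = 0 ∧ rMat q 1 1 1 1 = q := by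
  simp [rMat]
theorem rInv_tab (q : ℂ) :
    rInv q 0 0 0 0 = q⁻¹ ∧ rInv q 0 0 0 1 = 0 ∧ rInv q 0 0 1 0 = 0 ∧ rInv q 0 0 1 1 = 0 ∧ rInv q 0 1 0 0 = 0 ∧ rInv q 0 1 0 1 = 1 ∧ rInv q 0 1 1 0 = q⁻¹ - q ∧ rInv q 0 1 1 1 = 0 ∧ rInv q 1 0 0 0 = 0 ∧ rInv q 1 0 0 1 = 0 ∧ rInv q 1 0 1 0 = 1 ∧ rInv q 1 0 1 1 = 0 ∧ rInv q 1 1 0 0 = 0 ∧ rInv q 1 1 0 1 = 0 ∧ rInv q 1 1 1 0 = 0 ∧ rInv q 1 1 1 1 = q⁻¹ := by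
  simp [rInv]
theorem rTilde_tab (q : ℂ) :
    rTilde q 0 0 0 0 = q⁻¹ ∧ rTilde q 0 0 0 1 = 0 ∧ rTilde q 0 0 1 0 = 0 ∧ rTilde q 0 0 1 1 = 0 ∧ rTilde q 0 1 0 0 = 0 ∧ rTilde q 0 1 0 1 = 1 ∧ rTilde q 0 1 1 0 = -(q⁻¹ ^ 2 * (q - q⁻¹)) ∧ rTilde q 0 1 1 1 = 0 ∧ rTilde q 1 0 0 0 = 0 ∧ rTilde q 1 0 0 1 = 0 ∧ rTilde q 1 0 1 0 = 1 ∧ rTilde q 1 0 1 1 = 0 ∧ rTilde q 1 1 0 0 = 0 ∧ rTilde q 1 1 0 1 = 0 ∧ rTilde q 1 1 1 0 = 0 ∧ rTilde q 1 1 1 1 = q⁻¹ := by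
  simp [rTilde]

theorem fstIdx_tab : fstIdx 0 = 0 ∧ fstIdx 1 = 0 ∧ fstIdx 2 = 1 ∧ fstIdx 3 = 1 := ⟨rfl, rfl, rfl, rfl⟩
theorem sndIdx_tab : sndIdx 0 = 0 ∧ sndIdx 1 = 1 ∧ sndIdx 2 = 0 ∧ sndIdx 3 = 1 := ⟨rfl, rfl, rfl, rfl⟩

theorem rL_row {q : ℝ} (hq : q ≠ 0) (G : Fin 4 → Fin 4 → ℂ) : ∀ a b : Fin 4,
    ∑ c, ∑ d, rL q a b c d * G c d = rowL ((q : ℂ) ^ 2) ((q : ℂ) ^ 2)⁻¹ G a b := by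
  have hq' : (q : ℂ) ≠ 0 := by exact_mod_cast hq
  simp only [rL]
  generalize (q : ℂ) = z at *
  refine forall4 ?_ ?_ ?_ ?_ <;> refine forall4 ?_ ?_ ?_ ?_ <;>
    simp only [Fin.sum_univ_four, fstIdx_tab, sndIdx_tab, Fin.sum_univ_two, rMat_tab, rTilde_tab,
      zero_mul, mul_zero, add_zero, zero_add, one_mul, mul_one, rowL] <;> field_simp <;> ring

theorem rM_row {q : ℝ} (hq : q ≠ 0) (G : Fin 4 → Fin 4 → ℂ) : ∀ a b : Fin 4,
    ∑ c, ∑ d, rM q a b c d * G c d = rowM ((q : ℂ) ^ 2) ((q : ℂ) ^ 2)⁻¹ G a b := by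
  have hq' : (q : ℂ) ≠ 0 := by exact_mod_cast hq
  simp only [rM]
  generalize (q : ℂ) = z at *
  refine forall4 ?_ ?_ ?_ ?_ <;> refine forall4 ?_ ?_ ?_ ?_ <;>
    simp only [Fin.sum_univ_four, fstIdx_tab, sndIdx_tab, Fin.sum_univ_two, rMat_tab, rInv_tab,
      rTilde_tab, zero_mul, mul_zero, add_zero, zero_add, one_mul, mul_one, rowM] <;>
    field_simp <;> ring

theorem hecke (u : ℂ) (hu : u ≠ 0) (F : Fin 4 → Fin 4 → ℂ) : ∀ m a : Fin 4,
    F a m + rowL u u⁻¹ F m a = rowM u u⁻¹ F m a +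
      rowL u u⁻¹ (fun b c => rowM u u⁻¹ F c b) m a := by
  refine forall4 ?_ ?_ ?_ ?_ <;> refine forall4 ?_ ?_ ?_ ?_ <;>
    simp only [rowL, rowM] <;> field_simp <;> ring

theorem mixed (u : ℂ) (hu : u ≠ 0) (F : Fin 4 → Fin 4 → Fin 4 → ℂ) : ∀ m n a : Fin 4,
    rowL u u⁻¹ (fun b k => rowL u u⁻¹ (fun c l => rowM u u⁻¹ (fun d e => F d e l) c b) n k) m a
    = rowM u u⁻¹ (fun i j => rowL u u⁻¹ (fun b k => rowL u u⁻¹ (fun c l => F b c l) j k) i a) n m := by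
  refine forall4 ?_ ?_ ?_ ?_ <;> refine forall4 ?_ ?_ ?_ ?_ <;> refine forall4 ?_ ?_ ?_ ?_ <;>
    simp only [rowL, rowM] <;> field_simp <;> ring

/-- The R-matrix identity behind the compatibility of the braided Leibniz rule with the relations
of `M_q`, in first order: `(1 + P R_L)(1 - P R_M) = 0`. -/
theorem hecke_identity {q : ℝ} (hq : q ≠ 0) (m a d e : Fin 4) :
    (if d = a ∧ e = m then 1 else 0) + rL q m a d e =
      rM q m a d e + ∑ b, ∑ c, rL q m a b c * rM q c b d e := by
  have hu : (q : ℂ) ^ 2 ≠ 0 := pow_ne_zero _ (by exact_mod_cast hq)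
  have h := hecke _ hu (fun d' e' => if d' = d ∧ e' = e then 1 else 0) m a
  simp only [← rL_row hq, ← rM_row hq] at h
  simp only [mul_ite, mul_one, mul_zero, ite_and, Finset.sum_ite_irrel, Finset.sum_const_zero,
    Finset.sum_ite_eq', Finset.mem_univ, if_true] at h
  rw [← h]
  simp only [ite_and, eq_comm]

/-- The mixed Yang-Baxter equation of `R_L` and `R_M`. -/
theorem mixed_identity {q : ℝ} (hq : q ≠ 0) (m n a d e l : Fin 4) :
    ∑ b, ∑ k, ∑ c, rL q m a b k * rL q n k c l * rM q c b d e =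
      ∑ i, ∑ j, ∑ k, rM q n m i j * rL q i a d k * rL q j k e l := by
  have hu : (q : ℂ) ^ 2 ≠ 0 := pow_ne_zero _ (by exact_mod_cast hq)
  have h := mixed _ hu (fun d' e' l' => if d' = d ∧ e' = e ∧ l' = l then 1 else 0) m n a
  simp only [← rL_row hq, ← rM_row hq] at h
  simp only [mul_ite, mul_one, mul_zero, ite_and, Finset.sum_ite_irrel, Finset.sum_const_zero,
    Finset.sum_ite_eq', Finset.mem_univ, if_true, Finset.mul_sum] at h
  simpa only [mul_assoc] using h

/-! ### Braided differential operators -/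

/-- The action of `x_b` from the left on pairs `(f, (∂^a f)_a)`, according to the braided Leibniz
rule. -/
def leibnizOp (q : ℝ) (b : Fin 4) : Module.End ℂ (Mq q × (Fin 4 → Mq q)) where
  toFun F := (x q b * F.1, fun a => (if a = b then F.1 else 0) +
    ∑ m, ∑ k, rL q m a b k • (x q m * F.2 k))
  map_add' F G := by
    ext a
    · simp [mul_add]
    · simp only [Prod.fst_add, Prod.snd_add, Pi.add_apply, mul_add, smul_add,
        Finset.sum_add_distrib]
      split_ifs <;> abel
  map_smul' r F := by
    ext a
    · simp
    · simp [Finset.smul_sum, smul_comm r]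

theorem sum_rot3 {M : Type*} [AddCommMonoid M] (f : Fin 4 → Fin 4 → Fin 4 → M) :
    ∑ a, ∑ b, ∑ c, f a b c = ∑ c, ∑ a, ∑ b, f a b c :=
  (Finset.sum_congr rfl fun _ _ => Finset.sum_comm).trans Finset.sum_comm

theorem sum_rot4 {M : Type*} [AddCommMonoid M] (f : Fin 4 → Fin 4 → Fin 4 → Fin 4 → M) :
    ∑ a, ∑ b, ∑ c, ∑ d, f a b c d = ∑ d, ∑ a, ∑ b, ∑ c, f a b c d :=
  (Finset.sum_congr rfl fun _ _ => sum_rot3 _).trans Finset.sum_comm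

theorem sum_rot5 {M : Type*} [AddCommMonoid M] (f : Fin 4 → Fin 4 → Fin 4 → Fin 4 → Fin 4 → M) :
    ∑ a, ∑ b, ∑ c, ∑ d, ∑ e, f a b c d e = ∑ e, ∑ a, ∑ b, ∑ c, ∑ d, f a b c d e :=
  (Finset.sum_congr rfl fun _ _ => sum_rot4 _).trans Finset.sum_comm

theorem leibnizOp_mul {q : ℝ} (hq : q ≠ 0) (b c : Fin 4) :
    leibnizOp q b * leibnizOp q c =
      ∑ i, ∑ j, rM q i j b c • (leibnizOp q j * leibnizOp q i) := by
  apply LinearMap.ext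
  rintro ⟨f, F⟩
  refine Prod.ext ?_ (funext fun a => ?_)
  · simp only [Module.End.mul_apply, LinearMap.sum_apply, LinearMap.smul_apply, Prod.fst_sum,
      Prod.smul_fst, leibnizOp, LinearMap.coe_mk, AddHom.coe_mk]
    rw [← mul_assoc, x_mul_x, Finset.sum_mul]
    simp only [Finset.sum_mul, smul_mul_assoc, mul_assoc]
  · simp only [Module.End.mul_apply, LinearMap.sum_apply, LinearMap.smul_apply, Prod.snd_sum,
      Prod.smul_snd, leibnizOp, LinearMap.coe_mk, AddHom.coe_mk, Finset.sum_apply, Pi.smul_apply]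
    simp only [mul_add, smul_add, Finset.sum_add_distrib, Finset.mul_sum, Finset.smul_sum]
    have h1 : (if a = b then x q c * f else 0) +
        ∑ m, ∑ k, rL q m a b k • (x q m * if k = c then f else 0) =
        ∑ m, ((if b = a ∧ c = m then 1 else 0) + rL q m a b c) • (x q m * f) := by
      simp only [add_smul, Finset.sum_add_distrib, mul_ite, mul_zero, smul_ite, smul_zero,
        ite_smul, one_smul, zero_smul, Finset.sum_ite_eq', Finset.mem_univ, if_true]
      congr 1
      by_cases h : a = b
      · simp [h]
      · simp [h, Ne.symm h]
    have h2 : (∑ i, ∑ j, rM q i j b c • (if a = j then x q i * f else 0)) +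
        ∑ i, ∑ j, ∑ m, ∑ k, rM q i j b c • rL q m a j k • (x q m * if k = i then f else 0) =
        ∑ m, (rM q m a b c + ∑ j, ∑ i, rL q m a j i * rM q i j b c) • (x q m * f) := by
      simp only [add_smul, Finset.sum_add_distrib, mul_ite, mul_zero, smul_ite, smul_zero,
        Finset.sum_ite_eq, Finset.sum_ite_eq', Finset.mem_univ, if_true, Finset.sum_smul]
      congr 1
      rw [Finset.sum_comm, Finset.sum_comm (s := Finset.univ) (t := Finset.univ)
        (f := fun m j => ∑ i, (rL q m a j i * rM q i j b c) • (x q m * f))]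
      refine Finset.sum_congr rfl fun j _ => ?_
      rw [Finset.sum_comm]
      refine Finset.sum_congr rfl fun m _ => Finset.sum_congr rfl fun i _ => ?_
      rw [smul_smul, mul_comm]
    have h3 : ∑ m, ∑ k, ∑ n, ∑ l, rL q m a b k • (x q m * rL q n k c l • (x q n * F l)) =
        ∑ i, ∑ j, ∑ m, ∑ k, ∑ n, ∑ l,
          rM q i j b c • rL q m a j k • (x q m * rL q n k i l • (x q n * F l)) := by
      have e1 : ∑ m, ∑ k, ∑ n, ∑ l, rL q m a b k • (x q m * rL q n k c l • (x q n * F l)) =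
          ∑ i, ∑ j, ∑ l, (∑ k, rL q i a b k * rL q j k c l) • ((x q i * x q j) * F l) := by
        refine Finset.sum_congr rfl fun i _ => ?_
        rw [Finset.sum_comm]
        refine Finset.sum_congr rfl fun j _ => ?_
        rw [Finset.sum_comm]
        refine Finset.sum_congr rfl fun l _ => ?_
        rw [Finset.sum_smul]
        refine Finset.sum_congr rfl fun k _ => ?_
        rw [mul_smul_comm, smul_smul, mul_assoc]
      have e2 : ∑ i, ∑ j, ∑ m, ∑ k, ∑ n, ∑ l,
            rM q i j b c • rL q m a j k • (x q m * rL q n k i l • (x q n * F l)) =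
          ∑ m, ∑ n, ∑ l, (∑ j, ∑ k, ∑ i, rL q m a j k * rL q n k i l * rM q i j b c) •
            (x q m * (x q n * F l)) := by
        simp only [Finset.sum_smul, mul_smul_comm, smul_smul]
        refine (sum_rot3 _).trans (Finset.sum_congr rfl fun m _ => ?_)
        refine (sum_rot4 _).trans (Finset.sum_congr rfl fun n _ => ?_)
        refine (sum_rot4 _).trans (Finset.sum_congr rfl fun l _ => ?_)
        refine Finset.sum_comm.trans (Finset.sum_congr rfl fun j _ => ?_)
        refine Finset.sum_comm.trans (Finset.sum_congr rfl fun k _ => ?_)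
        refine Finset.sum_congr rfl fun i _ => ?_
        congr 1
        ring
      have e3 : ∀ m n l, (∑ j, ∑ k, ∑ i, rL q m a j k * rL q n k i l * rM q i j b c) •
            (x q m * (x q n * F l)) =
          ∑ i, ∑ j, (rM q n m i j * ∑ k, rL q i a b k * rL q j k c l) •
            (x q m * (x q n * F l)) := by
        intro m n l
        rw [mixed_identity hq]
        simp only [Finset.mul_sum, Finset.sum_smul, mul_assoc]
      have e4 : ∀ i j l, (∑ k, rL q i a b k * rL q j k c l) • ((x q i * x q j) * F l) =
          ∑ n, ∑ m, (rM q n m i j * ∑ k, rL q i a b k * rL q j k c l) •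
            (x q m * (x q n * F l)) := by
        intro i j l
        generalize ∑ k, rL q i a b k * rL q j k c l = S
        rw [x_mul_x q i j, Finset.sum_mul, Finset.smul_sum]
        refine Finset.sum_congr rfl fun n _ => ?_
        rw [Finset.sum_mul, Finset.smul_sum]
        refine Finset.sum_congr rfl fun m _ => ?_
        rw [smul_mul_assoc, smul_smul, mul_comm S, mul_assoc]
      rw [e1, e2]
      simp only [e3, e4]
      refine (sum_rot5 _).trans (Finset.sum_congr rfl fun m _ => ?_)
      refine (sum_rot4 _).trans (Finset.sum_congr rfl fun n _ => ?_)
      exact sum_rot3 _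
    rw [← add_assoc, h1, h3, ← add_assoc, h2]
    simp only [hecke_identity hq]

/-- The assignment `x_b ↦ leibnizOp q b` as an action of `M_q`. -/
def leibnizHom (q : ℝ) [NeZero q] : Mq q →ₐ[ℂ] Module.End ℂ (Mq q × (Fin 4 → Mq q)) :=
  RingQuot.liftAlgHom ℂ ⟨FreeAlgebra.lift ℂ (leibnizOp q), by
    rintro _ _ ⟨b, c⟩
    simpa [map_sum] using leibnizOp_mul (NeZero.ne q) b c⟩

theorem leibnizHom_x (q : ℝ) [NeZero q] (b : Fin 4) : leibnizHom q (x q b) = leibnizOp q b := by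
  simp [leibnizHom, x]

/-- The braided differential operator `∂^a` on `M_q`. It is determined by `∂^a 1 = 0` and the
braided Leibniz rule on generators, see `partialUp_one` and `partialUp_x_mul`. -/
def partialUp (q : ℝ) [NeZero q] (a : Fin 4) : Mq q →ₗ[ℂ] Mq q :=
  (LinearMap.proj a ∘ₗ LinearMap.snd ℂ (Mq q) (Fin 4 → Mq q)) ∘ₗ
    LinearMap.applyₗ ((1 : Mq q), (0 : Fin 4 → Mq q)) ∘ₗ (leibnizHom q).toLinearMap

theorem partialUp_one (q : ℝ) [NeZero q] (a : Fin 4) : partialUp q a 1 = 0 := by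
  simp [partialUp]

theorem mq_induction (q : ℝ) {P : Mq q → Prop} (h1 : P 1)
    (hadd : ∀ f g, P f → P g → P (f + g)) (hsmul : ∀ (r : ℂ) f, P f → P (r • f))
    (hx : ∀ b f, P f → P (x q b * f)) (f : Mq q) : P f := by
  obtain ⟨f, rfl⟩ := RingQuot.mkAlgHom_surjective ℂ (MRel q) f
  suffices h : ∀ g, P g → P (RingQuot.mkAlgHom ℂ (MRel q) f * g) by simpa using h 1 h1
  induction f using FreeAlgebra.induction with
  | grade0 r =>
    intro g hg
    rw [AlgHom.commutes, ← Algebra.smul_def]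
    exact hsmul r g hg
  | grade1 b => exact fun g hg => hx b g hg
  | mul f₁ f₂ h₁ h₂ =>
    intro g hg
    rw [map_mul, mul_assoc]
    exact h₁ _ (h₂ g hg)
  | add f₁ f₂ h₁ h₂ =>
    intro g hg
    rw [map_add, add_mul]
    exact hadd _ _ (h₁ g hg) (h₂ g hg)

theorem leibnizHom_fst (q : ℝ) [NeZero q] (f : Mq q) : (leibnizHom q f (1, 0)).1 = f := by
  induction f using mq_induction q with
  | h1 => simp
  | hadd f g hf hg => simp [hf, hg]
  | hsmul r f hf => simp [hf]
  | hx b f hf =>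
    rw [map_mul, leibnizHom_x, Module.End.mul_apply]
    simp [leibnizOp, hf]

/-- The braided Leibniz rule `∂^a (x_b f) = δ^a_b f + x_m R_L^{ma}_{bk} ∂^k f`. -/
theorem partialUp_x_mul (q : ℝ) [NeZero q] (a b : Fin 4) (f : Mq q) :
    partialUp q a (x q b * f) =
      (if a = b then f else 0) + ∑ m, ∑ k, rL q m a b k • (x q m * partialUp q k f) := by
  have h := leibnizHom_fst q f
  simp only [partialUp, LinearMap.comp_apply, AlgHom.toLinearMap_apply, LinearMap.applyₗ_apply_apply,
    map_mul, leibnizHom_x, Module.End.mul_apply, LinearMap.proj_apply, LinearMap.snd_apply]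
  simp [leibnizOp, h]

/-! ### The algebra `Y` of labels -/

/-- The relations of `Y` for the generators `p^a` (`Sum.inl a`) and `A_a` (`Sum.inr a`). The
relations `momentum` and `cone` are those of the q-light cone `P_0`, the relations `amplitude` are
those of `M_q`, and `cross` are the relations `A_b p^n = Ψ (A_b ⊗ p^n)` of the braided tensor
product of `P_0` and `M_q` for the braiding
`Ψ (A_m ⊗ p^a) = p^k ⊗ A_l (R̃_L)^{la}_{mk}`, where `R̃_L = ((R_L^{t₂})⁻¹)^{t₂}`,
with the inverse moved to the other side. -/
inductive YRel (q : ℝ) : FreeAlgebra ℂ (Fin 4 ⊕ Fin 4) → FreeAlgebra ℂ (Fin 4 ⊕ Fin 4) → Prop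
  | momentum (a b : Fin 4) : YRel q
      (FreeAlgebra.ι ℂ (Sum.inl a) * FreeAlgebra.ι ℂ (Sum.inl b))
      (∑ c, ∑ d, rM q a b c d •
        (FreeAlgebra.ι ℂ (Sum.inl d) * FreeAlgebra.ι ℂ (Sum.inl c)))
  | cone : YRel q
      (∑ a, ∑ b, gLow q a b • (FreeAlgebra.ι ℂ (Sum.inl a) * FreeAlgebra.ι ℂ (Sum.inl b))) 0
  | amplitude (a b : Fin 4) : YRel q
      (FreeAlgebra.ι ℂ (Sum.inr a) * FreeAlgebra.ι ℂ (Sum.inr b))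
      (∑ c, ∑ d, rM q c d a b •
        (FreeAlgebra.ι ℂ (Sum.inr d) * FreeAlgebra.ι ℂ (Sum.inr c)))
  | cross (n b : Fin 4) : YRel q
      (FreeAlgebra.ι ℂ (Sum.inl n) * FreeAlgebra.ι ℂ (Sum.inr b))
      (∑ m, ∑ a, rL q m n b a •
        (FreeAlgebra.ι ℂ (Sum.inr m) * FreeAlgebra.ι ℂ (Sum.inl a)))
  | gauge : YRel q
      (∑ c, FreeAlgebra.ι ℂ (Sum.inl c) * FreeAlgebra.ι ℂ (Sum.inr c)) 0

/-- The algebra `Y`: the quotient of the braided tensor product of the q-light cone `P_0` and of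
`M_q` by `p^c ⊗ A_c = 0`. -/
abbrev Yq (q : ℝ) : Type := RingQuot (YRel q)

/-- The momenta `p^a`. -/
def p (q : ℝ) (a : Fin 4) : Yq q :=
  RingQuot.mkAlgHom ℂ (YRel q) (FreeAlgebra.ι ℂ (Sum.inl a))

/-- The amplitudes `A_a`. -/
def amp (q : ℝ) (a : Fin 4) : Yq q :=
  RingQuot.mkAlgHom ℂ (YRel q) (FreeAlgebra.ι ℂ (Sum.inr a))

/-! ### Formal power series and plane waves -/

/-- The component of degree `n` of `M_q`. -/
def Mdeg (q : ℝ) (n : ℕ) : Submodule ℂ (Mq q) := Submodule.span ℂ (Set.range (x q)) ^ n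

theorem x_mul_mem {q : ℝ} {n : ℕ} (b : Fin 4) {f : Mq q} (hf : f ∈ Mdeg q n) :
    x q b * f ∈ Mdeg q (n + 1) := by
  rw [Mdeg, pow_succ']
  exact Submodule.mul_mem_mul (Submodule.subset_span ⟨b, rfl⟩) hf

theorem partialUp_mem (q : ℝ) [NeZero q] (a : Fin 4) (n : ℕ) :
    ∀ f ∈ Mdeg q (n + 1), partialUp q a f ∈ Mdeg q n := by
  induction n generalizing a with
  | zero =>
    intro f hf
    rw [Mdeg, zero_add, pow_one] at hf
    induction hf using Submodule.span_induction with
    | mem f hf =>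
      obtain ⟨b, rfl⟩ := hf
      rw [← mul_one (x q b), partialUp_x_mul]
      simp only [partialUp_one, mul_zero, smul_zero, Finset.sum_const_zero, add_zero]
      split_ifs
      · rw [Mdeg, pow_zero]; exact Submodule.one_le.mp le_rfl
      · exact zero_mem _
    | zero => simp
    | add f g _ _ hf hg => rw [map_add]; exact add_mem hf hg
    | smul r f _ hf => rw [map_smul]; exact Submodule.smul_mem _ r hf
  | succ n ih =>
    intro f hf
    rw [Mdeg, pow_succ'] at hf
    induction hf using Submodule.mul_induction_on' with
    | mem_mul_mem y hy g hg =>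
      induction hy using Submodule.span_induction with
      | mem y hy =>
        obtain ⟨b, rfl⟩ := hy
        rw [partialUp_x_mul]
        refine add_mem ?_ (sum_mem fun m _ => sum_mem fun k _ =>
          Submodule.smul_mem _ _ (x_mul_mem m (ih k g hg)))
        split_ifs
        · exact hg
        · exact zero_mem _
      | zero => simp
      | add y z _ _ hy hz => rw [add_mul, map_add]; exact add_mem hy hz
      | smul r y _ hy => rw [smul_mul_assoc, map_smul]; exact Submodule.smul_mem _ r hy
    | add f _ g _ hf hg => rw [map_add]; exact add_mem hf hg

theorem list_prod_mem (q : ℝ) (n : ℕ) (a : Fin n → Fin 4) :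
    (List.ofFn fun i => x q (a i)).prod ∈ Mdeg q n := by
  induction n with
  | zero => simpa [Mdeg] using Submodule.one_le.mp (le_refl (1 : Submodule ℂ (Mq q)))
  | succ n ih =>
    rw [List.ofFn_succ, List.prod_cons]
    exact x_mul_mem _ (ih _)

/-- The formal power series in `M_q ⊗ Y`: families `(f_n)` with `f_n` in `(M_q)_n ⊗ Y`. -/
abbrev Series (q : ℝ) : Type := ∀ n : ℕ, Mdeg q n ⊗[ℂ] Yq q

/-- `∂^a` on formal power series in `M_q ⊗ Y`, acting on the factor `M_q`. -/
def partialSeries (q : ℝ) [NeZero q] (a : Fin 4) : Series q →ₗ[ℂ] Series q :=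
  LinearMap.pi fun n =>
    LinearMap.rTensor (Yq q) ((partialUp q a).restrict (partialUp_mem q a n)) ∘ₗ
      LinearMap.proj (n + 1)

/-- Multiplication of formal power series by `y ∈ Y` from the right. -/
def mulRightSeries (q : ℝ) (y : Yq q) : Series q →ₗ[ℂ] Series q :=
  LinearMap.pi fun n =>
    LinearMap.lTensor (Mdeg q n) (LinearMap.mulRight ℂ y) ∘ₗ LinearMap.proj n

/-- `[n]! = [1] ⋯ [n]` with `[n] = 1 + q + ⋯ + q^{n-1}`. -/
def qFactorial (q : ℝ) (n : ℕ) : ℝ :=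
  ∏ k ∈ Finset.range n, ∑ j ∈ Finset.range (k + 1), q ^ j

/-- `exp (i x.p) = ∑ iⁿ / [n]! x_{a₁} ⋯ x_{a_n} ⊗ p^{a_n} ⋯ p^{a₁}`. -/
def expIxp (q : ℝ) : Series q := fun n =>
  (Complex.I ^ n / (qFactorial q n : ℂ)) • ∑ a : Fin n → Fin 4,
    (⟨(List.ofFn fun i => x q (a i)).prod, list_prod_mem q n a⟩ : Mdeg q n) ⊗ₜ[ℂ]
      (List.ofFn fun i => p q (a i)).reverse.prod

/-- `exp (i x.p) ⊗ A_z`. -/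
def planeWave (q : ℝ) (z : Fin 4) : Series q := mulRightSeries q (amp q z) (expIxp q)

end QMinkowski

end

noncomputable section

open scoped TensorProduct

namespace QMinkowski

/-! ### Relations in `Y` -/

/-! On the q-light cone a plane wave is an eigenfunction of the derivatives in the following weak
sense. Call a series of the form `∑ c_n x_{a₁} ⋯ x_{a_n} ⊗ p^{a_n} ⋯ p^{a₁} y`, with any scalars
`c_n` and any `y` in `Y`, a wave with amplitude `y`. Then `∂^a` turns it into another wave, with
amplitude `p^a y` and coefficients `c_{n+1} [n+1]`, where `[n+1]` is a q²-integer
(`partialSeries_wave`). The new coefficients depend neither on `a` nor on `y`, so no relation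
between the `c_n` is needed: `d` and `*` act on forms whose components are waves with common
coefficients by acting on their amplitudes, with `∂_a` replaced by left multiplication by `p_a`
(`extD_wave`, `hodge_wave`).

The formula for the derivative comes from the braided Leibniz rule by induction on the degree
(`partial_pairing`). Moving `∂^a` past `x_b` produces `R_L` contracted with a product of two
momenta, and the commutation relations together with `g_{ab} p^a p^b = 0` make this contraction
multiplication by `q²` (`rL_p_mul_p`).

What remains is algebra in `Y`. Classically the Maxwell operator has, up to sign, the symbol `p² A -
p (p·A)`, which vanishes when `p² = 0` and `p·A = 0`; the gauge condition is `p·A = 0` itself. The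
q-versions are `maxwell_contract` and `lorentz_contract`: the contractions with the q-antisymmetric
tensors reduce to multiples of `p^d p^c A_c` and of `p^c A_c`. They give `d * d A = 0` and `d * A =
0`, so that the outer star of `δ` plays no part. Linear functionals on `Y` turn these identities
into polynomial identities between complex numbers. -/

theorem p_mul_p (q : ℝ) (a b : Fin 4) :
    p q a * p q b = ∑ c, ∑ d, rM q a b c d • (p q d * p q c) := by
  have h := RingQuot.mkAlgHom_rel ℂ (YRel.momentum (q := q) a b)
  simpa [p, map_sum] using h

theorem cone_relation (q : ℝ) : ∑ a, ∑ b, gLow q a b • (p q a * p q b) = 0 := by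
  have h := RingQuot.mkAlgHom_rel ℂ (YRel.cone (q := q))
  simpa [p, map_sum] using h

theorem gauge_relation (q : ℝ) : ∑ c, p q c * amp q c = 0 := by
  have h := RingQuot.mkAlgHom_rel ℂ (YRel.gauge (q := q))
  simpa [p, amp, map_sum] using h

/-- The commutation relations of the light cone, solved for the monomials `P^{01}`, `P^{02}`,
`P^{12}`, `P^{21}`, `P^{23}`, `P^{30}`, `P^{31}`. -/
structure LightCone (u : ℂ) (P : Fin 4 → Fin 4 → ℂ) : Prop where
  h01 : P 0 1 = P 1 0 - (u - 1) * P 1 3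
  h02 : P 0 2 = P 2 0 + (u - 1) * P 3 2
  h12 : P 1 2 = P 0 3 + (1 - u⁻¹) * P 3 3
  h21 : P 2 1 = u * P 0 3
  h23 : P 2 3 = u * P 3 2
  h30 : P 3 0 = P 0 3
  h31 : P 3 1 = u * P 1 3

/-- The commutation relations alone determine all listed monomials except that they leave `P 1 2`
and `P 2 1` tied by a single equation; the cone relation supplies the second one. -/
theorem LightCone.of_relations {u : ℂ} (hu : u ≠ 0) (hu' : 1 + u ≠ 0) {P : Fin 4 → Fin 4 → ℂ}
    (h : ∀ a b, P a b = rowM u u⁻¹ (fun c d => P d c) a b)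
    (hc : P 0 3 - P 1 2 - u⁻¹ * P 2 1 + P 3 0 + (1 - u⁻¹) * P 3 3 = 0) : LightCone u P := by
  have h01 := h 0 1
  have h02 := h 0 2
  have h12 := h 1 2
  have h30 := h 3 0
  have h31 := h 3 1
  have h32 := h 3 2
  simp only [rowM] at h01 h02 h12 h30 h31 h32
  have h23 : P 2 3 = u * P 3 2 := by rw [h32]; field_simp
  -- After `P 1 2` and `P 3 0` are eliminated from the cone relation, the `P 3 3` terms cancel and
  -- `(1 + u) P 0 3 = (1 + u⁻¹) P 2 1` remains. This is where `1 + u ≠ 0` enters.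
  have h21 : P 2 1 = u * P 0 3 := by
    have h : (1 + u) * P 2 1 = (1 + u) * (u * P 0 3) := by
      field_simp at hc h12
      linear_combination u * h30 - hc - h12
    exact mul_left_cancel₀ hu' h
  refine ⟨?_, ?_, ?_, h21, h23, h30, h31⟩
  · rw [h31] at h01
    field_simp at h01
    linear_combination h01
  · rw [h23] at h02
    field_simp at h02
    apply mul_left_cancel₀ hu
    apply mul_left_cancel₀ hu
    linear_combination h02
  · rw [h12, h21]
    ring

theorem LightCone.rowL_eq {u : ℂ} (hu : u ≠ 0) {P : Fin 4 → Fin 4 → ℂ} (h : LightCone u P) :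
    ∀ m a, rowL u u⁻¹ (fun b k => P k b) m a = u * P m a := by
  refine forall4 ?_ ?_ ?_ ?_ <;> refine forall4 ?_ ?_ ?_ ?_ <;>
    simp only [rowL, h.h01, h.h02, h.h12, h.h21, h.h23, h.h30, h.h31] <;> field_simp <;> ring

/-- A functional `φ` replaces the noncommuting products by complex numbers, for which the relations
form a linear system. Its solution requires `1 + q² ≠ 0`, which holds because `q` is real. -/
theorem lightCone_apply {q : ℝ} (hq : q ≠ 0) (φ : Yq q →ₗ[ℂ] ℂ) :
    LightCone ((q : ℂ) ^ 2) fun a b => φ (p q a * p q b) := by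
  have hq' : (q : ℂ) ≠ 0 := by exact_mod_cast hq
  have hu' : 1 + (q : ℂ) ^ 2 ≠ 0 := by
    have h : (1 + q ^ 2 : ℝ) ≠ 0 := by positivity
    exact_mod_cast h
  refine .of_relations (pow_ne_zero 2 hq') hu' (fun a b => ?_) ?_
  · rw [← rM_row hq]
    conv_lhs => rw [p_mul_p]
    simp [map_sum]
  · have h := congrArg φ (cone_relation q)
    simp [Fin.sum_univ_four, gLow] at h
    linear_combination h

/-- Linear functionals separate the points of a vector space. Identities in `Y` can therefore be
checked on scalars, where commutative ring normalisation is available. -/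
theorem eq_of_forall_dual {V : Type*} [AddCommGroup V] [Module ℂ V] {v w : V}
    (h : ∀ φ : V →ₗ[ℂ] ℂ, φ v = φ w) : v = w := by
  rw [← sub_eq_zero, ← Module.forall_dual_apply_eq_zero_iff ℂ]
  intro φ
  rw [map_sub, h φ, sub_self]

/-- On the light cone, `P R_L` acts as `q²`. -/
theorem rL_p_mul_p {q : ℝ} (hq : q ≠ 0) (m a : Fin 4) :
    ∑ b, ∑ k, rL q m a b k • (p q k * p q b) = (q : ℂ) ^ 2 • (p q m * p q a) := by
  have hu : (q : ℂ) ^ 2 ≠ 0 := pow_ne_zero _ (by exact_mod_cast hq)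
  refine eq_of_forall_dual fun φ => ?_
  have h := (lightCone_apply hq φ).rowL_eq hu m a
  rw [← rL_row hq] at h
  simpa [map_sum] using h

/-! ### Derivatives of plane waves -/

/-- Multiplication by `x_b` from the left. -/
def xMul (q : ℝ) (b : Fin 4) (n : ℕ) : Mdeg q n →ₗ[ℂ] Mdeg q (n + 1) :=
  (LinearMap.mulLeft ℂ (x q b)).restrict fun _ hf => x_mul_mem b hf

/-- The derivative `∂^a` on polynomials of degree `n + 1`. -/
def partialDeg (q : ℝ) [NeZero q] (a : Fin 4) (n : ℕ) : Mdeg q (n + 1) →ₗ[ℂ] Mdeg q n :=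
  (partialUp q a).restrict (partialUp_mem q a n)

/-- Degree zero consists of the scalars, which all derivatives kill, so the braided term of the
Leibniz rule is absent. The case is separate because `partialDeg` is only defined on degrees `n +
1`. -/
theorem partialDeg_comp_xMul_zero (q : ℝ) [NeZero q] (a b : Fin 4) :
    partialDeg q a 0 ∘ₗ xMul q b 0 = if a = b then LinearMap.id else 0 := by
  refine LinearMap.ext fun f => Subtype.ext ?_
  have hf : ∀ k, partialUp q k (f : Mq q) = 0 := by
    obtain ⟨f, hf⟩ := f
    rw [Mdeg, pow_zero, Submodule.mem_one] at hf
    obtain ⟨r, rfl⟩ := hf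
    intro k
    simp [Algebra.algebraMap_eq_smul_one, partialUp_one]
  have h := partialUp_x_mul q a b (f : Mq q)
  simp only [hf, mul_zero, smul_zero, Finset.sum_const_zero, add_zero] at h
  refine h.trans ?_
  split_ifs <;> rfl

theorem partialDeg_comp_xMul_succ (q : ℝ) [NeZero q] (a b : Fin 4) (n : ℕ) :
    partialDeg q a (n + 1) ∘ₗ xMul q b (n + 1) =
      (if a = b then LinearMap.id else 0) +
        ∑ m, ∑ k, rL q m a b k • (xMul q m n ∘ₗ partialDeg q k n) := by
  refine LinearMap.ext fun f => Subtype.ext ?_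
  refine (partialUp_x_mul q a b (f : Mq q)).trans ?_
  simp only [LinearMap.add_apply, LinearMap.sum_apply, LinearMap.smul_apply, Submodule.coe_add,
    Submodule.coe_sum, Submodule.coe_smul, LinearMap.comp_apply]
  congr 1
  split_ifs <;> rfl

/-- The sum `x_{a₁} ⋯ x_{a_n} ⊗ p^{a_n} ⋯ p^{a₁}`. -/
def pairing (q : ℝ) (n : ℕ) : Mdeg q n ⊗[ℂ] Yq q :=
  ∑ a : Fin n → Fin 4,
    (⟨(List.ofFn fun i => x q (a i)).prod, list_prod_mem q n a⟩ : Mdeg q n) ⊗ₜ[ℂ]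
      (List.ofFn fun i => p q (a i)).reverse.prod

/-- The momenta are multiplied in reverse order, so splitting off the first index puts `x_b` at the
far left and `p^b` at the far right. -/
theorem pairing_succ (q : ℝ) (n : ℕ) :
    pairing q (n + 1) =
      ∑ b, TensorProduct.map (xMul q b n) (LinearMap.mulRight ℂ (p q b)) (pairing q n) := by
  rw [pairing, ← (Fin.consEquiv fun _ => Fin 4).sum_comp, Fintype.sum_prod_type]
  refine Finset.sum_congr rfl fun b _ => ?_
  rw [pairing, map_sum]
  refine Finset.sum_congr rfl fun a _ => ?_
  rw [TensorProduct.map_tmul]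
  congr 1
  · refine Subtype.ext ?_
    simp only [Fin.consEquiv_apply, List.ofFn_succ, Fin.cons_zero, Fin.cons_succ, List.prod_cons]
    rfl
  · simp [List.ofFn_succ]

/-- The map `y ↦ (f ⊗ (· y)) t`. -/
def rightMap {q : ℝ} {M N : Type*} [AddCommMonoid M] [AddCommMonoid N] [Module ℂ M] [Module ℂ N]
    (f : M →ₗ[ℂ] N) (t : M ⊗[ℂ] Yq q) : Yq q →ₗ[ℂ] N ⊗[ℂ] Yq q where
  toFun y := TensorProduct.map f (LinearMap.mulRight ℂ y) t
  map_add' y z := by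
    rw [← LinearMap.add_apply, ← TensorProduct.map_add_right]
    congr 2
    -- Right multiplication depends linearly on the multiplier, being the flipped multiplication
    -- map.
    exact map_add (LinearMap.mul ℂ (Yq q)).flip y z
  map_smul' r y := by
    rw [RingHom.id_apply, ← LinearMap.smul_apply, ← TensorProduct.map_smul_right]
    congr 2
    exact map_smul (LinearMap.mul ℂ (Yq q)).flip r y

theorem rightMap_apply {q : ℝ} {M N : Type*} [AddCommMonoid M] [AddCommMonoid N] [Module ℂ M]
    [Module ℂ N] (f : M →ₗ[ℂ] N) (t : M ⊗[ℂ] Yq q) (y : Yq q) :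
    rightMap f t y = TensorProduct.map f (LinearMap.mulRight ℂ y) t := rfl

theorem map_mulRight_mulRight {q : ℝ} {M N : Type*} [AddCommMonoid M] [AddCommMonoid N]
    [Module ℂ M] [Module ℂ N] (f : M →ₗ[ℂ] N) (y z : Yq q) (t : M ⊗[ℂ] Yq q) :
    TensorProduct.map f (LinearMap.mulRight ℂ y) (LinearMap.lTensor M (LinearMap.mulRight ℂ z) t) =
      TensorProduct.map f (LinearMap.mulRight ℂ (z * y)) t := by
  rw [LinearMap.lTensor, ← LinearMap.comp_apply, ← TensorProduct.map_comp, LinearMap.comp_id,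
    LinearMap.mulRight_mul]

/-- The q²-integer `[n]`. -/
def sqInt (q : ℝ) (n : ℕ) : ℂ := ∑ j ∈ Finset.range n, ((q : ℂ) ^ 2) ^ j

/-- With `x_b` split off, the delta term of the Leibniz rule contributes one copy of the right hand
side. In the braided term the induction hypothesis produces `p^k p^b`, and `R_L` acts on it as `q²`;
hence the recursion `[n+2] = 1 + q² [n+1]`. -/
theorem partial_pairing (q : ℝ) [NeZero q] (n : ℕ) : ∀ a : Fin 4,
    LinearMap.rTensor (Yq q) (partialDeg q a n) (pairing q (n + 1)) =
      sqInt q (n + 1) • LinearMap.lTensor (Mdeg q n) (LinearMap.mulRight ℂ (p q a))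
        (pairing q n) := by
  induction n with
  | zero =>
    intro a
    rw [pairing_succ, map_sum]
    simp only [LinearMap.rTensor, ← LinearMap.comp_apply, ← TensorProduct.map_comp,
      LinearMap.id_comp, partialDeg_comp_xMul_zero]
    rw [Finset.sum_eq_single a (fun b _ hb => by simp [Ne.symm hb]) (by simp)]
    simp [sqInt, LinearMap.lTensor]
  | succ n ih =>
    intro a
    -- `rightMap` is linear in its last argument, so a relation of `Y` can be applied inside it.
    have hL : ∀ m, ∑ b, ∑ k, rL q m a b k • rightMap (xMul q m n) (pairing q n) (p q k * p q b) =
        (q : ℂ) ^ 2 • rightMap (xMul q m n) (pairing q n) (p q m * p q a) := by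
      intro m
      simp only [← map_smul, ← map_sum, rL_p_mul_p (NeZero.ne q)]
    -- The derivative produces `p^k` before the right multiplication by `p^b`, whence the order `p^k
    -- p^b`.
    have h1 : ∀ b m k, TensorProduct.map (xMul q m n ∘ₗ partialDeg q k n)
        (LinearMap.mulRight ℂ (p q b)) (pairing q (n + 1)) =
        sqInt q (n + 1) • rightMap (xMul q m n) (pairing q n) (p q k * p q b) := by
      intro b m k
      rw [← LinearMap.comp_id (LinearMap.mulRight ℂ (p q b)), TensorProduct.map_comp,
        LinearMap.comp_apply, ← LinearMap.rTensor, ih k, map_smul, map_mulRight_mulRight,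
        rightMap_apply]
    have h2 : ∀ b, LinearMap.rTensor (Yq q) (partialDeg q a (n + 1))
        (TensorProduct.map (xMul q b (n + 1)) (LinearMap.mulRight ℂ (p q b))
          (pairing q (n + 1))) =
        (if a = b then LinearMap.lTensor (Mdeg q (n + 1)) (LinearMap.mulRight ℂ (p q a))
          (pairing q (n + 1)) else 0) + sqInt q (n + 1) • ∑ m, ∑ k,
            rL q m a b k • rightMap (xMul q m n) (pairing q n) (p q k * p q b) := by
      intro b
      rw [LinearMap.rTensor, ← LinearMap.comp_apply, ← TensorProduct.map_comp,
        LinearMap.id_comp, partialDeg_comp_xMul_succ, TensorProduct.map_add_left,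
        LinearMap.add_apply]
      congr 1
      · split_ifs with h
        · rw [h, LinearMap.lTensor]
        · simp
      · have hs : ∀ g : Fin 4 → Fin 4 → Mdeg q (n + 1) →ₗ[ℂ] Mdeg q (n + 1),
            TensorProduct.map (∑ m, ∑ k, g m k) (LinearMap.mulRight ℂ (p q b)) =
              ∑ m, ∑ k, TensorProduct.map (g m k) (LinearMap.mulRight ℂ (p q b)) := by
          intro g
          simp only [Fin.sum_univ_four, TensorProduct.map_add_left]
        rw [hs]
        simp only [LinearMap.sum_apply, TensorProduct.map_smul_left, LinearMap.smul_apply, h1,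
          Finset.smul_sum]
        exact Finset.sum_congr rfl fun m _ => Finset.sum_congr rfl fun k _ => smul_comm _ _ _
    rw [pairing_succ, map_sum]
    simp only [h2, Finset.sum_add_distrib, Finset.sum_ite_eq, Finset.mem_univ, if_true]
    rw [← Finset.smul_sum, Finset.sum_comm]
    simp only [hL]
    rw [← Finset.smul_sum, smul_smul]
    have h3 : ∑ m, rightMap (xMul q m n) (pairing q n) (p q m * p q a) =
        LinearMap.lTensor (Mdeg q (n + 1)) (LinearMap.mulRight ℂ (p q a))
          (pairing q (n + 1)) := by
      rw [pairing_succ, map_sum]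
      refine Finset.sum_congr rfl fun m _ => ?_
      rw [LinearMap.lTensor, ← LinearMap.comp_apply, ← TensorProduct.map_comp,
        LinearMap.id_comp, ← LinearMap.mulRight_mul, rightMap_apply]
    rw [h3]
    have h4 : sqInt q (n + 1 + 1) = 1 + sqInt q (n + 1) * (q : ℂ) ^ 2 := by
      rw [sqInt, Finset.sum_range_succ', sqInt, Finset.sum_mul]
      simp only [pow_succ, pow_zero]
      ring
    rw [h4, add_smul, one_smul]

/-- The series with the terms `c_n x_{a₁} ⋯ x_{a_n} ⊗ p^{a_n} ⋯ p^{a₁} y`. -/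
def wave (q : ℝ) (c : ℕ → ℂ) : Yq q →ₗ[ℂ] Series q :=
  LinearMap.pi fun n => c n • rightMap LinearMap.id (pairing q n)

theorem planeWave_eq_wave (q : ℝ) (z : Fin 4) :
    planeWave q z = wave q (fun n => Complex.I ^ n / (qFactorial q n : ℂ)) (amp q z) := by
  funext n
  exact map_smul (LinearMap.lTensor (Mdeg q n) (LinearMap.mulRight ℂ (amp q z))) _ (pairing q n)

/-- The derivative acts on the left tensor factor and commutes with right multiplication by `y`, so
the new `p^a` lands between the old momenta and `y`. -/
theorem partialSeries_wave (q : ℝ) [NeZero q] (a : Fin 4) (c : ℕ → ℂ) (y : Yq q) :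
    partialSeries q a (wave q c y) =
      wave q (fun n => c (n + 1) * sqInt q (n + 1)) (p q a * y) := by
  funext n
  change LinearMap.rTensor (Yq q) (partialDeg q a n)
      (c (n + 1) • LinearMap.lTensor _ (LinearMap.mulRight ℂ y) (pairing q (n + 1))) =
    (c (n + 1) * sqInt q (n + 1)) •
      LinearMap.lTensor _ (LinearMap.mulRight ℂ (p q a * y)) (pairing q n)
  rw [map_smul, mul_smul, ← LinearMap.comp_apply, LinearMap.rTensor_comp_lTensor,
    ← LinearMap.lTensor_comp_rTensor, LinearMap.comp_apply, partial_pairing, map_smul,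
    LinearMap.lTensor, map_mulRight_mulRight, LinearMap.lTensor]

/-! ### Contractions with the q-antisymmetric tensor -/

/-- The components of `ε_{abcd}`, as `4 × 4` tables for fixed `a`, `b`, with `u = q²`, `t = q⁻²`. -/
def epsTab (u t : ℂ) : Fin 4 → Fin 4 → Fin 4 → Fin 4 → ℂ
  | 0, 0 => ![![0, 0, 0, 0], ![0, 0, 0, 0], ![0, 0, 0, 0], ![0, 0, 0, 0]]
  | 0, 1 => ![![0, 0, 0, 0], ![0, 0, 0, 0], ![0, 0, 0, 1], ![0, 0, -t, 0]]
  | 0, 2 => ![![0, 0, 0, 0], ![0, 0, 0, -1], ![0, 0, 0, 0], ![0, u, 0, 0]]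
  | 0, 3 => ![![0, 0, 0, 1 - u], ![0, 0, 1, 0], ![0, -1, 0, 0], ![0, 0, 0, 1 - t]]
  | 1, 0 => ![![0, 0, 0, 0], ![0, 0, 0, 0], ![0, 0, 0, -1], ![0, 0, t, 0]]
  | 1, 1 => ![![0, 0, 0, 0], ![0, 0, 0, 0], ![0, 0, 0, 0], ![0, 0, 0, 0]]
  | 1, 2 => ![![0, 0, 0, 1], ![0, 0, 0, 0], ![0, 0, 0, 0], ![-1, 0, 0, 0]]
  | 1, 3 => ![![0, 0, -t, 0], ![0, 0, 0, 0], ![t, 0, 0, t - 1], ![0, 0, 0, 0]]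
  | 2, 0 => ![![0, 0, 0, 0], ![0, 0, 0, 1], ![0, 0, 0, 0], ![0, -u, 0, 0]]
  | 2, 1 => ![![0, 0, 0, -1], ![0, 0, 0, 0], ![0, 0, 0, 0], ![1, 0, 0, 0]]
  | 2, 2 => ![![0, 0, 0, 0], ![0, 0, 0, 0], ![0, 0, 0, 0], ![0, 0, 0, 0]]
  | 2, 3 => ![![0, u, 0, 0], ![-u, 0, 0, 1 - u], ![0, 0, 0, 0], ![0, 0, 0, 0]]
  | 3, 0 => ![![0, 0, 0, 0], ![0, 0, -1, 0], ![0, 1, 0, 0], ![u - 1, 0, 0, t - 1]]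
  | 3, 1 => ![![0, 0, 1, 0], ![0, 0, 0, 0], ![-1, 0, 0, 0], ![0, 0, 1 - t, 0]]
  | 3, 2 => ![![0, -1, 0, 0], ![1, 0, 0, 0], ![0, 0, 0, 0], ![0, u - 1, 0, 0]]
  | 3, 3 => ![![0, 0, 0, 1 - t], ![0, 0, 0, 0], ![0, 0, 0, 0], ![t - 1, 0, 0, 0]]

/-- The catch-all case of `epsLow` is replaced by explicit zeros, so that later sums evaluate entry
by entry. -/
theorem epsLow_eq_epsTab (q : ℝ) : ∀ a b c d,
    epsLow q a b c d = epsTab ((q : ℂ) ^ 2) ((q : ℂ)⁻¹ ^ 2) a b c d := by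
  refine forall4 ?_ ?_ ?_ ?_ <;> refine forall4 ?_ ?_ ?_ ?_ <;> refine forall4 ?_ ?_ ?_ ?_ <;>
    exact forall4 rfl rfl rfl rfl

theorem sum_table (m₀₀ m₀₁ m₀₂ m₀₃ m₁₀ m₁₁ m₁₂ m₁₃ m₂₀ m₂₁ m₂₂ m₂₃ m₃₀ m₃₁ m₃₂ m₃₃ : ℂ)
    (G : Fin 4 → Fin 4 → ℂ) :
    ∑ i, ∑ j, (![![m₀₀, m₀₁, m₀₂, m₀₃], ![m₁₀, m₁₁, m₁₂, m₁₃], ![m₂₀, m₂₁, m₂₂, m₂₃],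
      ![m₃₀, m₃₁, m₃₂, m₃₃]] : Fin 4 → Fin 4 → ℂ) i j * G i j =
    m₀₀ * G 0 0 + m₀₁ * G 0 1 + m₀₂ * G 0 2 + m₀₃ * G 0 3 + (m₁₀ * G 1 0 + m₁₁ * G 1 1 +
      m₁₂ * G 1 2 + m₁₃ * G 1 3) + (m₂₀ * G 2 0 + m₂₁ * G 2 1 + m₂₂ * G 2 2 + m₂₃ * G 2 3) +
      (m₃₀ * G 3 0 + m₃₁ * G 3 1 + m₃₂ * G 3 2 + m₃₃ * G 3 3) := by
  simp [Fin.sum_univ_four]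

/-- The contraction `ε_{abij} G^{ij}`, with `u = q²`, `t = q⁻²`. -/
def rowEps (u t : ℂ) (G : Fin 4 → Fin 4 → ℂ) : Fin 4 → Fin 4 → ℂ
  | 0, 0 => 0
  | 0, 1 => G 2 3 - t * G 3 2
  | 0, 2 => -G 1 3 + u * G 3 1
  | 0, 3 => (-u + 1) * G 0 3 + G 1 2 - G 2 1 + (1 - t) * G 3 3
  | 1, 0 => -G 2 3 + t * G 3 2
  | 1, 1 => 0
  | 1, 2 => G 0 3 - G 3 0
  | 1, 3 => -t * G 0 2 + t * G 2 0 + (-1 + t) * G 2 3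
  | 2, 0 => G 1 3 - u * G 3 1
  | 2, 1 => -G 0 3 + G 3 0
  | 2, 2 => 0
  | 2, 3 => u * G 0 1 - u * G 1 0 + (-u + 1) * G 1 3
  | 3, 0 => -G 1 2 + G 2 1 + (u - 1) * G 3 0 + (-1 + t) * G 3 3
  | 3, 1 => G 0 2 - G 2 0 + (1 - t) * G 3 2
  | 3, 2 => -G 0 1 + G 1 0 + (u - 1) * G 3 1
  | 3, 3 => (1 - t) * G 0 3 + (-1 + t) * G 3 0

/-- The contraction `ε_{ijab} G^{ij}`, with `u = q²`, `t = q⁻²`. -/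
def rowEpsLeft (u t : ℂ) (G : Fin 4 → Fin 4 → ℂ) : Fin 4 → Fin 4 → ℂ
  | 0, 0 => 0
  | 0, 1 => u * G 2 3 - G 3 2
  | 0, 2 => -t * G 1 3 + G 3 1
  | 0, 3 => (-u + 1) * G 0 3 + G 1 2 - G 2 1 + (1 - t) * G 3 3
  | 1, 0 => -u * G 2 3 + G 3 2
  | 1, 1 => 0
  | 1, 2 => G 0 3 - G 3 0
  | 1, 3 => -G 0 2 + G 2 0 + (-u + 1) * G 2 3
  | 2, 0 => t * G 1 3 - G 3 1
  | 2, 1 => -G 0 3 + G 3 0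
  | 2, 2 => 0
  | 2, 3 => G 0 1 - G 1 0 + (-1 + t) * G 1 3
  | 3, 0 => -G 1 2 + G 2 1 + (u - 1) * G 3 0 + (-1 + t) * G 3 3
  | 3, 1 => u * G 0 2 - u * G 2 0 + (u - 1) * G 3 2
  | 3, 2 => -t * G 0 1 + t * G 1 0 + (1 - t) * G 3 1
  | 3, 3 => (1 - t) * G 0 3 + (-1 + t) * G 3 0

/-- The contraction `ε^{abij} G_{ij}`, with `u = q²`, `t = q⁻²`. -/
def rowEpsUp (u t : ℂ) (G : Fin 4 → Fin 4 → ℂ) : Fin 4 → Fin 4 → ℂ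
  | 0, 0 => (-u + 1) * G 0 3 + (u - 1) * G 3 0
  | 0, 1 => (u - 1) * G 0 2 + u * G 2 3 - u * G 3 2
  | 0, 2 => (1 - t) * G 0 1 - u * G 1 3 + u * G 3 1
  | 0, 3 => (-u + 1) * G 0 0 + (u - 1) * G 0 3 + u * G 1 2 - u * G 2 1
  | 1, 0 => (-u + 1) * G 2 0 - u ^ 2 * G 2 3 + u ^ 2 * G 3 2
  | 1, 1 => 0
  | 1, 2 => u * G 0 3 - u * G 3 0
  | 1, 3 => -u ^ 2 * G 0 2 + u * G 2 0
  | 2, 0 => (-1 + t) * G 1 0 + G 1 3 - G 3 1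
  | 2, 1 => -u * G 0 3 + u * G 3 0
  | 2, 2 => 0
  | 2, 3 => G 0 1 - u * G 1 0
  | 3, 0 => (u - 1) * G 0 0 - u * G 1 2 + u * G 2 1 + (-u + 1) * G 3 0
  | 3, 1 => u ^ 2 * G 0 2 - u * G 2 0
  | 3, 2 => -G 0 1 + u * G 1 0
  | 3, 3 => 0

/-- The contraction `ε_{abij} g^{il} g^{jk} G_{kl}`, with `u = q²`, `t = q⁻²`. -/
def rowHodge (u t : ℂ) (G : Fin 4 → Fin 4 → ℂ) : Fin 4 → Fin 4 → ℂ
  | 0, 0 => 0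
  | 0, 1 => -u * G 0 1 + G 1 0
  | 0, 2 => G 0 2 - u * G 2 0
  | 0, 3 => (u - 1) * G 0 0 + (-u + 1) * G 0 3 + u * G 1 2 - u * G 2 1
  | 1, 0 => u * G 0 1 - G 1 0
  | 1, 1 => 0
  | 1, 2 => G 0 3 - G 3 0
  | 1, 3 => (u - t) * G 0 1 + (-1 + t) * G 1 0 + G 1 3 - G 3 1
  | 2, 0 => -G 0 2 + u * G 2 0
  | 2, 1 => -G 0 3 + G 3 0
  | 2, 2 => 0
  | 2, 3 => (u - 1) * G 2 0 - u * G 2 3 + u * G 3 2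
  | 3, 0 => (-u + 1) * G 0 0 - u * G 1 2 + u * G 2 1 + (u - 1) * G 3 0
  | 3, 1 => (-u + 1) * G 0 1 - u * G 1 3 + u * G 3 1
  | 3, 2 => (1 - t) * G 0 2 + (-u + t) * G 2 0 + G 2 3 - G 3 2
  | 3, 3 => (1 - t) * G 0 3 + (-1 + t) * G 3 0

theorem epsLow_row (q : ℝ) (G : Fin 4 → Fin 4 → ℂ) : ∀ a b : Fin 4,
    ∑ i, ∑ j, epsLow q a b i j * G i j = rowEps ((q : ℂ) ^ 2) ((q : ℂ)⁻¹ ^ 2) G a b := by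
  refine forall4 ?_ ?_ ?_ ?_ <;> refine forall4 ?_ ?_ ?_ ?_ <;>
    simp only [epsLow_eq_epsTab, epsTab, sum_table, rowEps, zero_mul, one_mul] <;> ring

theorem epsLow_row_left (q : ℝ) (G : Fin 4 → Fin 4 → ℂ) : ∀ a b : Fin 4,
    ∑ i, ∑ j, epsLow q i j a b * G i j = rowEpsLeft ((q : ℂ) ^ 2) ((q : ℂ)⁻¹ ^ 2) G a b := by
  refine forall4 ?_ ?_ ?_ ?_ <;> refine forall4 ?_ ?_ ?_ ?_ <;>
    simp only [epsLow_eq_epsTab, epsTab, Fin.sum_univ_four, Matrix.cons_val, rowEpsLeft,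
      zero_mul, one_mul] <;> ring

/-- The contraction `g^{ij} G_j`. -/
def gRow (u t : ℂ) (G : Fin 4 → ℂ) : Fin 4 → ℂ
  | 0 => -(1 - t) * G 0 + G 3
  | 1 => -G 2
  | 2 => -u * G 1
  | 3 => G 0

/-- The contraction `g^{ji} G_j`. -/
def gCol (u t : ℂ) (G : Fin 4 → ℂ) : Fin 4 → ℂ
  | 0 => -(1 - t) * G 0 + G 3
  | 1 => -u * G 2
  | 2 => -G 1
  | 3 => G 0

theorem gUp_row {q : ℝ} (hq : q ≠ 0) (G : Fin 4 → ℂ) : ∀ i : Fin 4,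
    ∑ j, gUp q i j * G j = gRow ((q : ℂ) ^ 2) ((q : ℂ)⁻¹ ^ 2) G i := by
  refine forall4 ?_ ?_ ?_ ?_ <;> simp [gUp_eq hq, Fin.sum_univ_four, gRow]

theorem gUp_col {q : ℝ} (hq : q ≠ 0) (G : Fin 4 → ℂ) : ∀ i : Fin 4,
    ∑ j, gUp q j i * G j = gCol ((q : ℂ) ^ 2) ((q : ℂ)⁻¹ ^ 2) G i := by
  refine forall4 ?_ ?_ ?_ ?_ <;> simp [gUp_eq hq, Fin.sum_univ_four, gCol]

theorem sum_rot6 {M : Type*} [AddCommMonoid M]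
    (f : Fin 4 → Fin 4 → Fin 4 → Fin 4 → Fin 4 → Fin 4 → M) :
    ∑ a, ∑ b, ∑ c, ∑ d, ∑ e, ∑ g, f a b c d e g = ∑ g, ∑ a, ∑ b, ∑ c, ∑ d, ∑ e, f a b c d e g :=
  (Finset.sum_congr rfl fun _ _ => sum_rot5 _).trans Finset.sum_comm

/-- The four metrics and `ε_{klmn}` are contracted one after another, each by its own short table;
this avoids expanding the sixfold sum. -/
theorem epsUp_row {q : ℝ} (hq : q ≠ 0) (G : Fin 4 → Fin 4 → ℂ) (a b : Fin 4) :
    ∑ i, ∑ j, epsUp q a b i j * G i j = rowEpsUp ((q : ℂ) ^ 2) ((q : ℂ)⁻¹ ^ 2) G a b := by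
  have h : ∑ i, ∑ j, epsUp q a b i j * G i j =
      ∑ k, gUp q k a * ∑ l, gUp q l b * ∑ m, ∑ n, epsLow q k l m n *
        ∑ i, gUp q m i * ∑ j, gUp q n j * G i j := by
    simp only [epsUp, Finset.sum_mul, Finset.mul_sum]
    -- Once expanded, the sums over `i` and `j` are innermost; two rotations bring them to the
    -- front.
    refine Eq.symm ((sum_rot6 _).trans ((sum_rot6 _).trans ?_))
    simp only [mul_left_comm, mul_comm, mul_assoc]
  have hq' : (q : ℂ) ≠ 0 := by exact_mod_cast hq
  rw [h]
  simp only [epsLow_row, gUp_row hq, gUp_col hq]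
  clear h
  generalize (q : ℂ) = z at hq' ⊢
  revert a b
  refine forall4 ?_ ?_ ?_ ?_ <;> refine forall4 ?_ ?_ ?_ ?_ <;>
    simp only [gCol, gRow, rowEps, rowEpsUp] <;> field_simp <;> ring

theorem hodge_row {q : ℝ} (hq : q ≠ 0) (G : Fin 4 → Fin 4 → ℂ) (a b : Fin 4) :
    ∑ k, ∑ l, hodgeKernel q 2 ![k, l] ![a, b] * G k l =
      rowHodge ((q : ℂ) ^ 2) ((q : ℂ)⁻¹ ^ 2) G a b := by
  have h : ∑ k, ∑ l, hodgeKernel q 2 ![k, l] ![a, b] * G k l =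
      ∑ i, ∑ j, epsLow q a b i j * ∑ l, gUp q i l * ∑ k, gUp q j k * G k l := by
    simp only [hodgeKernel, Finset.sum_mul, Finset.mul_sum]
    refine Eq.symm ((sum_rot4 _).trans (Finset.sum_congr rfl fun k _ => (sum_rot3 _).trans ?_))
    simp only [Matrix.cons_val_zero, Matrix.cons_val_one, mul_assoc]
  have hq' : (q : ℂ) ≠ 0 := by exact_mod_cast hq
  rw [h]
  simp only [epsLow_row, gUp_row hq]
  clear h
  generalize (q : ℂ) = z at hq' ⊢
  revert a b
  refine forall4 ?_ ?_ ?_ ?_ <;> refine forall4 ?_ ?_ ?_ ?_ <;>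
    simp only [gRow, rowEps, rowHodge] <;> field_simp <;> ring

/-! ### The q-antisymmetrisers and the q-Hodge star -/

/-- `n_2` times the q-antisymmetrisation of a tensor with two indices. -/
def rowAlt (u t : ℂ) (G : Fin 4 → Fin 4 → ℂ) : Fin 4 → Fin 4 → ℂ :=
  rowEpsLeft u t fun c d => rowEpsUp u t (fun i j => G j i) d c

/-- The image of the star is already q-antisymmetric, so the antisymmetriser only contributes its
normalisation `n_2 = (1 + u)²`. -/
theorem rowAlt_rowHodge {u : ℂ} (hu : u ≠ 0) (G : Fin 4 → Fin 4 → ℂ) : ∀ a b : Fin 4,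
    rowAlt u u⁻¹ (rowHodge u u⁻¹ G) a b = (1 + u) ^ 2 * rowHodge u u⁻¹ G a b := by
  refine forall4 ?_ ?_ ?_ ?_ <;> refine forall4 ?_ ?_ ?_ ?_ <;>
    simp only [rowAlt, rowHodge, rowEpsLeft, rowEpsUp] <;> field_simp <;> ring

/-- Dually, the star sees only the q-antisymmetric part of a tensor. -/
theorem rowHodge_rowAlt {u : ℂ} (hu : u ≠ 0) (G : Fin 4 → Fin 4 → ℂ) : ∀ a b : Fin 4,
    rowHodge u u⁻¹ (rowAlt u u⁻¹ G) a b = (1 + u) ^ 2 * rowHodge u u⁻¹ G a b := by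
  refine forall4 ?_ ?_ ?_ ?_ <;> refine forall4 ?_ ?_ ?_ ?_ <;>
    simp only [rowAlt, rowHodge, rowEpsLeft, rowEpsUp] <;> field_simp <;> ring

theorem sum_reverse4 {M : Type*} [AddCommMonoid M] (f : Fin 4 → Fin 4 → Fin 4 → Fin 4 → M) :
    ∑ a, ∑ b, ∑ c, ∑ d, f a b c d = ∑ d, ∑ c, ∑ b, ∑ a, f a b c d :=
  (sum_rot4 _).trans (Finset.sum_congr rfl fun _ _ =>
    (sum_rot3 _).trans (Finset.sum_congr rfl fun _ _ => Finset.sum_comm))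

theorem sum_fin_succ {M : Type*} [AddCommMonoid M] {n : ℕ} (f : (Fin (n + 1) → Fin 4) → M) :
    ∑ b, f b = ∑ i, ∑ c : Fin n → Fin 4, f (Matrix.vecCons i c) := by
  rw [← (Fin.consEquiv fun _ => Fin 4).sum_comp, Fintype.sum_prod_type]
  rfl

theorem sum_fin_zero {M : Type*} [AddCommMonoid M] (f : (Fin 0 → Fin 4) → M) :
    ∑ b, f b = f ![] := by
  rw [Fintype.sum_unique]
  congr

/-- `ε^{dcba} ε_{bcdh} G_a = -n_1 G_h`. -/
theorem epsUp_epsLow_contract {q : ℝ} (hq : q ≠ 0) (G : Fin 4 → ℂ) : ∀ h : Fin 4,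
    ∑ d, ∑ c, ∑ b, ∑ a, epsUp q d c b a * (epsLow q b c d h * G a) =
      -(2 * (1 + (q : ℂ) ^ 2 + (q : ℂ) ^ 4)) * G h := by
  have hq' : (q : ℂ) ≠ 0 := by exact_mod_cast hq
  simp only [epsUp_row hq, epsLow_eq_epsTab]
  generalize (q : ℂ) = z at *
  refine forall4 ?_ ?_ ?_ ?_ <;>
    simp only [Fin.sum_univ_four, rowEpsUp, epsTab, Matrix.cons_val] <;> field_simp <;> ring

theorem antisym_one {q : ℝ} (hq : q ≠ 0) (G : (Fin 1 → Fin 4) → ℂ) (v : Fin 1 → Fin 4) :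
    ∑ b, antisym q 1 b v * G b = G v := by
  have hn : (nFactor q 1 : ℂ) = 2 * (1 + (q : ℂ) ^ 2 + (q : ℂ) ^ 4) := by
    simp [nFactor]
  have hn0 : (nFactor q 1 : ℂ) ≠ 0 := by
    have h : nFactor q 1 ≠ 0 := by simp only [nFactor]; positivity
    exact_mod_cast h
  have h := epsUp_epsLow_contract hq (fun a => G ![a]) (v 0)
  rw [← hn] at h
  have hv : ![v 0] = v := by ext i; fin_cases i; rfl
  simp only [sum_fin_succ, sum_fin_zero, antisym, Matrix.cons_val_zero]
  rw [hv] at h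
  have h' : ∑ i, -(nFactor q 1 : ℂ)⁻¹ *
      (∑ b, ∑ c, ∑ d, epsUp q d c b i * epsLow q b c d (v 0)) * G ![i] =
      -(nFactor q 1 : ℂ)⁻¹ *
        ∑ d, ∑ c, ∑ b, ∑ a, epsUp q d c b a * (epsLow q b c d (v 0) * G ![a]) := by
    simp only [Finset.mul_sum, Finset.sum_mul]
    refine (sum_reverse4 _).trans ?_
    simp only [mul_assoc]
  rw [h', h]
  field_simp

theorem antisym_two {q : ℝ} (hq : q ≠ 0) (G : (Fin 2 → Fin 4) → ℂ) (v : Fin 2 → Fin 4) :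
    ∑ b, antisym q 2 b v * G b = ((1 + (q : ℂ) ^ 2) ^ 2)⁻¹ *
      rowAlt ((q : ℂ) ^ 2) ((q : ℂ)⁻¹ ^ 2) (fun i j => G ![i, j]) (v 0) (v 1) := by
  have hn : (nFactor q 2 : ℂ) = (1 + (q : ℂ) ^ 2) ^ 2 := by
    simp [nFactor, sq]
  simp only [rowAlt, ← epsUp_row hq, ← epsLow_row_left, sum_fin_succ, sum_fin_zero, antisym, hn]
  simp only [Finset.mul_sum, Finset.sum_mul, Matrix.cons_val_zero, Matrix.cons_val_one]
  refine (sum_rot4 _).trans ((sum_rot4 _).trans ?_)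
  refine Finset.sum_congr rfl fun c _ => Finset.sum_congr rfl fun d _ => ?_
  refine Finset.sum_comm.trans ?_
  refine Finset.sum_congr rfl fun j _ => Finset.sum_congr rfl fun i _ => ?_
  ring

/-- Contracting `ε^{dcba}` first leaves one vector indexed by `d`, and the antisymmetrisation
vanishes as soon as this vector does. `antisym_four` reduces in the same way to a single scalar. -/
theorem antisym_three {q : ℝ} (hq : q ≠ 0) (G : (Fin 3 → Fin 4) → ℂ) (v : Fin 3 → Fin 4) :
    ∑ b, antisym q 3 b v * G b = -(nFactor q 3 : ℂ)⁻¹ *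
      ∑ d, epsLow q d (v 0) (v 1) (v 2) *
        ∑ c, rowEpsUp ((q : ℂ) ^ 2) ((q : ℂ)⁻¹ ^ 2) (fun b a => G ![a, b, c]) d c := by
  simp only [← epsUp_row hq, sum_fin_succ, sum_fin_zero, antisym]
  simp only [Finset.mul_sum, Finset.sum_mul, Matrix.cons_val]
  refine (sum_reverse4 _).trans ?_
  refine Finset.sum_congr rfl fun d _ => Finset.sum_congr rfl fun c _ =>
    Finset.sum_congr rfl fun b _ => Finset.sum_congr rfl fun a _ => ?_
  ring

theorem antisym_four {q : ℝ} (hq : q ≠ 0) (G : (Fin 4 → Fin 4) → ℂ) (v : Fin 4 → Fin 4) :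
    ∑ b, antisym q 4 b v * G b = (nFactor q 4 : ℂ)⁻¹ * epsLow q (v 0) (v 1) (v 2) (v 3) *
      ∑ d, ∑ c, rowEpsUp ((q : ℂ) ^ 2) ((q : ℂ)⁻¹ ^ 2) (fun b a => G ![a, b, c, d]) d c := by
  simp only [← epsUp_row hq, sum_fin_succ, sum_fin_zero, antisym]
  simp only [Finset.mul_sum, Matrix.cons_val]
  refine (sum_reverse4 _).trans ?_
  refine Finset.sum_congr rfl fun d _ => Finset.sum_congr rfl fun c _ =>
    Finset.sum_congr rfl fun b _ => Finset.sum_congr rfl fun a _ => ?_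
  ring

/-- The contraction `g_{ab} G^b`. -/
def gLowRow (t : ℂ) (G : Fin 4 → ℂ) : Fin 4 → ℂ
  | 0 => G 3
  | 1 => -G 2
  | 2 => -t * G 1
  | 3 => G 0 + (1 - t) * G 3

theorem gLow_row (q : ℝ) (G : Fin 4 → ℂ) : ∀ a,
    ∑ b, gLow q a b * G b = gLowRow ((q : ℂ)⁻¹ ^ 2) G a := by
  refine forall4 ?_ ?_ ?_ ?_ <;> simp [gLow, Fin.sum_univ_four, gLowRow]

/-- The equation `δ d A = 0` for the amplitudes, where `S^{xy}_z` stands for `p^x p^y A_z`. -/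
theorem maxwell_contract {u : ℂ} (hu : u ≠ 0) {S : Fin 4 → Fin 4 → Fin 4 → ℂ}
    {T : Fin 4 → Fin 4 → Fin 4 → ℂ} (hS : ∀ z, LightCone u fun a b => S a b z)
    (hg : ∀ b, S b 0 0 + S b 1 1 + S b 2 2 + S b 3 3 = 0)
    (hT : ∀ a k l, T a k l = gLowRow u⁻¹ (fun x => gLowRow u⁻¹ (fun y => S x y l) k) a) : ∀ d,
    ∑ c, rowEpsUp u u⁻¹ (fun b a => rowHodge u u⁻¹ (T a) b c) d c = 0 := by
  have h01 := fun z => (hS z).h01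
  have h02 := fun z => (hS z).h02
  have h12 := fun z => (hS z).h12
  have h21 := fun z => (hS z).h21
  have h23 := fun z => (hS z).h23
  have h30 := fun z => (hS z).h30
  have h31 := fun z => (hS z).h31
  -- The light-cone relations bring all monomials to a common normal form; the q-analogue of the `p²
  -- A` term drops out and only `p^d (p^c A_c)` survives.
  have h : ∀ d, ∑ c, rowEpsUp u u⁻¹ (fun b a => rowHodge u u⁻¹ (T a) b c) d c =
      2 * u * (S d 0 0 + S d 1 1 + S d 2 2 + S d 3 3) := by
    refine forall4 ?_ ?_ ?_ ?_ <;>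
      simp only [Fin.sum_univ_four, rowEpsUp, rowHodge, hT, gLowRow, h01, h02, h12, h21,
        h23, h30, h31] <;> field_simp <;> ring
  intro d
  rw [h, hg, mul_zero]

/-- The contraction `ε^{flkj} ε_{jkli} G^i`. -/
theorem epsUp_epsTab_contract {u : ℂ} (hu : u ≠ 0) (G : Fin 4 → ℂ) : ∀ f : Fin 4,
    ∑ l, rowEpsUp u u⁻¹ (fun k j => ∑ i, epsTab u u⁻¹ j k l i * G i) f l =
      2 * (1 + u + u ^ 2) * ((![1, u, u⁻¹, 1] : Fin 4 → ℂ) f * G f) := by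
  refine forall4 ?_ ?_ ?_ ?_ <;>
    simp only [Fin.sum_univ_four, rowEpsUp, epsTab, Matrix.cons_val] <;> field_simp <;> ring

/-- The contraction `ε^{dcba} ε_{fbcd} Z_a^f`. -/
theorem epsUp_epsTab_trace {u : ℂ} (hu : u ≠ 0) (Z : Fin 4 → Fin 4 → ℂ) :
    ∑ d, ∑ c, rowEpsUp u u⁻¹ (fun b a => ∑ f, epsTab u u⁻¹ f b c d * Z a f) d c =
      2 * (1 + u + u ^ 2) * (Z 0 0 + u⁻¹ * Z 1 1 + u * Z 2 2 + Z 3 3) := by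
  simp only [Fin.sum_univ_four, rowEpsUp, epsTab, Matrix.cons_val]
  field_simp
  ring

/-- The gauge condition `δ A = 0` for the amplitudes, where `S^x_z` stands for `p^x A_z`. -/
theorem lorentz_contract {u : ℂ} (hu : u ≠ 0) (n : ℂ) {S : Fin 4 → Fin 4 → ℂ}
    (hg : S 0 0 + S 1 1 + S 2 2 + S 3 3 = 0) :
    ∑ d, ∑ c, rowEpsUp u u⁻¹ (fun b a => ∑ f, epsTab u u⁻¹ f b c d * (n *
      ∑ l, rowEpsUp u u⁻¹ (fun k j => ∑ i, epsTab u u⁻¹ j k l i *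
        gRow u u⁻¹ (fun z => gLowRow u⁻¹ (fun x => S x z) a) i) f l)) d c = 0 := by
  -- The weights `(1, u, u⁻¹, 1)` and `(1, u⁻¹, u, 1)` of the two contractions cancel on the
  -- diagonal, and `g^{fz} g_{fx} = δ^z_x` turns the remaining trace into `p^c A_c`.
  simp only [epsUp_epsTab_contract hu, epsUp_epsTab_trace hu, Matrix.cons_val]
  simp only [gRow, gLowRow]
  field_simp
  linear_combination (4 * u * n * (1 + u + u ^ 2) ^ 2) * hg

theorem rowEpsUp_smul (u t r : ℂ) (G : Fin 4 → Fin 4 → ℂ) : ∀ a b,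
    rowEpsUp u t (fun i j => r * G i j) a b = r * rowEpsUp u t G a b := by
  refine forall4 ?_ ?_ ?_ ?_ <;> refine forall4 ?_ ?_ ?_ ?_ <;> simp only [rowEpsUp] <;> ring

theorem rowEpsLeft_smul (u t r : ℂ) (G : Fin 4 → Fin 4 → ℂ) : ∀ a b,
    rowEpsLeft u t (fun i j => r * G i j) a b = r * rowEpsLeft u t G a b := by
  refine forall4 ?_ ?_ ?_ ?_ <;> refine forall4 ?_ ?_ ?_ ?_ <;> simp only [rowEpsLeft] <;> ring

theorem rowHodge_smul (u t r : ℂ) (G : Fin 4 → Fin 4 → ℂ) : ∀ a b,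
    rowHodge u t (fun i j => r * G i j) a b = r * rowHodge u t G a b := by
  refine forall4 ?_ ?_ ?_ ?_ <;> refine forall4 ?_ ?_ ?_ ?_ <;> simp only [rowHodge] <;> ring

theorem rowAlt_smul (u t r : ℂ) (G : Fin 4 → Fin 4 → ℂ) (a b : Fin 4) :
    rowAlt u t (fun i j => r * G i j) a b = r * rowAlt u t G a b := by
  simp only [rowAlt, rowEpsUp_smul, rowEpsLeft_smul]

theorem one_add_sq_ne_zero (q : ℝ) : 1 + (q : ℂ) ^ 2 ≠ 0 := by
  have h : (1 + q ^ 2 : ℝ) ≠ 0 := by positivity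
  exact_mod_cast h

/-- The q-Hodge star of the q-antisymmetrisation of a tensor with two indices. -/
theorem hodge_antisym_two {q : ℝ} (hq : q ≠ 0) (k : ℂ) (G : Fin 4 → Fin 4 → ℂ)
    (v : Fin 2 → Fin 4) :
    ∑ b, antisym q 2 b v * (k * ∑ c, hodgeKernel q 2 c b *
      ∑ d, antisym q 2 d c * G (d 0) (d 1)) =
    k * rowHodge ((q : ℂ) ^ 2) ((q : ℂ) ^ 2)⁻¹ G (v 0) (v 1) := by
  have hu : (q : ℂ) ^ 2 ≠ 0 := pow_ne_zero _ (by exact_mod_cast hq)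
  have hq1 := one_add_sq_ne_zero q
  have h := fun c : Fin 2 → Fin 4 => antisym_two hq (fun d => G (d 0) (d 1)) c
  simp only [Matrix.cons_val_zero, Matrix.cons_val_one] at h
  rw [antisym_two hq]
  -- Both antisymmetrisers are absorbed by the star; each leaves a factor `(1 + u)²` that cancels
  -- its `1 / n_2`.
  simp only [h, sum_fin_succ, sum_fin_zero, hodge_row hq, Matrix.cons_val_zero,
    Matrix.cons_val_one, rowHodge_smul, inv_pow, rowHodge_rowAlt hu, rowAlt_smul,
    rowAlt_rowHodge hu]
  field_simp

theorem hodge_row_one {q : ℝ} (hq : q ≠ 0) (G : Fin 4 → ℂ) (a b c : Fin 4) :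
    ∑ z, hodgeKernel q 1 ![z] ![a, b, c] * G z = ∑ i, epsTab ((q : ℂ) ^ 2) ((q : ℂ) ^ 2)⁻¹ a b c i *
      gRow ((q : ℂ) ^ 2) ((q : ℂ) ^ 2)⁻¹ G i := by
  simp only [← inv_pow, ← gUp_row hq, ← epsLow_eq_epsTab]
  simp only [hodgeKernel, Finset.sum_mul, Finset.mul_sum, Matrix.cons_val, mul_assoc]
  exact Finset.sum_comm

/-! ### The equations for the amplitudes -/

/-- The momenta `p_a = g_{ab} p^b`. -/
def pLow (q : ℝ) (a : Fin 4) : Yq q := ∑ b, gLow q a b • p q b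

theorem apply_pLow_mul (q : ℝ) (φ : Yq q →ₗ[ℂ] ℂ) (a : Fin 4) (y : Yq q) :
    φ (pLow q a * y) = gLowRow ((q : ℂ) ^ 2)⁻¹ (fun x => φ (p q x * y)) a := by
  rw [← inv_pow, ← gLow_row]
  simp [pLow, Finset.sum_mul]

/-- This is `d * d A = 0` at the level of amplitudes; `k` stands for the factor `n_2^{-1/2}` of the
inner star. -/
theorem maxwell_amplitude {q : ℝ} (hq : q ≠ 0) (k : ℂ) (v : Fin 3 → Fin 4) :
    ∑ b : Fin 3 → Fin 4, antisym q 3 b v • (pLow q (b 0) *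
      ∑ c : Fin 2 → Fin 4, antisym q 2 c (Fin.tail b) • k • ∑ d, hodgeKernel q 2 d c •
        ∑ f : Fin 2 → Fin 4, antisym q 2 f d • (pLow q (f 0) * amp q (f 1))) = 0 := by
  have hu : (q : ℂ) ^ 2 ≠ 0 := pow_ne_zero _ (by exact_mod_cast hq)
  refine eq_of_forall_dual fun φ => ?_
  -- Read as a functional of `y`, `φ (p_a y)` lets sums and scalars inside `y` be pulled out; the
  -- rewriting is undone afterwards.
  have hm : ∀ a y, φ (pLow q a * y) = (φ ∘ₗ LinearMap.mulLeft ℂ (pLow q a)) y := fun _ _ => rfl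
  rw [map_zero, map_sum]
  simp only [map_smul, hm]
  simp only [map_sum, map_smul, smul_eq_mul]
  simp only [← hm]
  have h := fun (a : Fin 4) (w : Fin 2 → Fin 4) => hodge_antisym_two hq k
    (fun i j => φ (pLow q a * (pLow q i * amp q j))) w
  simp only [h]
  have hc := maxwell_contract hu
    (S := fun x y z => φ (p q x * (p q y * amp q z)))
    (T := fun a i j => φ (pLow q a * (pLow q i * amp q j)))
    (fun z => by
      have h := lightCone_apply hq (φ ∘ₗ LinearMap.mulRight ℂ (amp q z))
      simpa [mul_assoc] using h)
    -- The gauge relation, multiplied by `p^b` from the left.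
    (fun b => by
      have h := congrArg (fun y => φ (p q b * y)) (gauge_relation q)
      simpa [Fin.sum_univ_four, mul_add] using h)
    (fun a i j => by
      rw [apply_pLow_mul]
      congr 1
      funext x
      exact apply_pLow_mul q (φ ∘ₗ LinearMap.mulLeft ℂ (p q x)) i (amp q j))
  rw [antisym_three hq]
  simp only [inv_pow, Fin.tail, Matrix.cons_val_zero, Matrix.cons_val_succ, Matrix.cons_val_one,
    rowEpsUp_smul, ← Finset.mul_sum]
  simp only [hc, mul_zero, Finset.sum_const_zero]

/-- This is `d * A = 0` at the level of amplitudes, with `k` in place of `n_1^{-1/2}`. Here the only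
relation of `Y` that enters is `p^c A_c = 0`. -/
theorem lorentz_amplitude {q : ℝ} (hq : q ≠ 0) (k : ℂ) (v : Fin 4 → Fin 4) :
    ∑ b : Fin 4 → Fin 4, antisym q 4 b v • (pLow q (b 0) *
      ∑ c : Fin 3 → Fin 4, antisym q 3 c (Fin.tail b) • k • ∑ d : Fin 1 → Fin 4,
        hodgeKernel q 1 d c • amp q (d 0)) = 0 := by
  have hu : (q : ℂ) ^ 2 ≠ 0 := pow_ne_zero _ (by exact_mod_cast hq)
  refine eq_of_forall_dual fun φ => ?_
  have hm : ∀ a y, φ (pLow q a * y) = (φ ∘ₗ LinearMap.mulLeft ℂ (pLow q a)) y := fun _ _ => rfl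
  rw [map_zero, map_sum]
  simp only [map_smul, hm]
  simp only [map_sum, map_smul, smul_eq_mul]
  simp only [← hm]
  have hc := lorentz_contract hu (-(nFactor q 3 : ℂ)⁻¹ * k)
    (S := fun x z => φ (p q x * amp q z))
    (by simpa [Fin.sum_univ_four] using congrArg φ (gauge_relation q))
  simp only [← apply_pLow_mul] at hc
  have h : ∀ (a : Fin 4) (w : Fin 3 → Fin 4), ∑ c, antisym q 3 c w * (k * ∑ d : Fin 1 → Fin 4,
      hodgeKernel q 1 d c * φ (pLow q a * amp q (d 0))) =
      ∑ f, epsTab ((q : ℂ) ^ 2) ((q : ℂ) ^ 2)⁻¹ f (w 0) (w 1) (w 2) *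
        ((-(nFactor q 3 : ℂ)⁻¹ * k) * ∑ l, rowEpsUp ((q : ℂ) ^ 2) ((q : ℂ) ^ 2)⁻¹ (fun k j => ∑ i,
          epsTab ((q : ℂ) ^ 2) ((q : ℂ) ^ 2)⁻¹ j k l i *
          gRow ((q : ℂ) ^ 2) ((q : ℂ) ^ 2)⁻¹ (fun z => φ (pLow q a * amp q z)) i) f l) := by
    intro a w
    rw [antisym_three hq]
    simp only [sum_fin_succ, sum_fin_zero, Matrix.cons_val_zero]
    simp only [hodge_row_one hq, inv_pow, rowEpsUp_smul, epsLow_eq_epsTab]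
    rw [Finset.mul_sum]
    refine Finset.sum_congr rfl fun f _ => ?_
    rw [← Finset.mul_sum]
    ring
  simp only [h]
  rw [antisym_four hq]
  simp only [inv_pow]
  refine (congrArg _ hc).trans (mul_zero _)

/-! ### Plane waves as q-Maxwell fields -/

theorem QForm.eq_zero {q : ℝ} {N : Type*} [AddCommMonoid N] [Module ℂ N] {p : ℕ}
    {w : QForm q N p} (h : ∀ a, w (e q a) = 0) : w = 0 := by
  refine LinearMap.ext fun v => ?_
  obtain ⟨v, hv⟩ := v
  induction hv using Submodule.span_induction with
  | mem v hv =>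
    obtain ⟨a, rfl⟩ := hv
    exact h a
  | zero => exact map_zero w
  | add v v' hv hv' h h' =>
    have hw := map_add w ⟨v, hv⟩ ⟨v', hv'⟩
    rw [h, h'] at hw
    exact hw.trans (add_zero 0)
  | smul r v hv h =>
    have hw := map_smul w r ⟨v, hv⟩
    rw [h] at hw
    exact hw.trans (smul_zero r)

theorem hodge_zero {q : ℝ} {N : Type*} [AddCommMonoid N] [Module ℂ N] {p : ℕ} :
    hodge q (0 : QForm q N p) = 0 :=
  QForm.eq_zero fun a => by simp [hodge, ofTensor_e]

theorem hodge_wave {q : ℝ} {r : ℕ} {w : QForm q (Series q) r} {c : ℕ → ℂ}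
    {W : (Fin r → Fin 4) → Yq q} (h : ∀ v, w (e q v) = wave q c (W v))
    (a : Fin (4 - r) → Fin 4) :
    hodge q w (e q a) = wave q c (∑ b, antisym q (4 - r) b a •
      (((Real.sqrt (nFactor q r))⁻¹ : ℝ) : ℂ) • ∑ d, hodgeKernel q r d b • W d) := by
  simp only [hodge, ofTensor_e, h, map_sum, map_smul]

theorem lower_wave (q : ℝ) [NeZero q] (a : Fin 4) (c : ℕ → ℂ) (y : Yq q) :
    lower q (partialSeries q) a (wave q c y) =
      wave q (fun n => c (n + 1) * sqInt q (n + 1)) (pLow q a * y) := by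
  simp only [lower, LinearMap.sum_apply, LinearMap.smul_apply, partialSeries_wave, pLow,
    Finset.sum_mul, smul_mul_assoc, map_sum, map_smul]

/-- All components share the coefficients `c`, and the derivative changes `c` in the same way for
every index, so the whole operation passes to the amplitudes and can be iterated. -/
theorem extD_wave {q : ℝ} [NeZero q] {r : ℕ} {w : QForm q (Series q) r} {c : ℕ → ℂ}
    {W : (Fin r → Fin 4) → Yq q} (h : ∀ v, w (e q v) = wave q c (W v))
    (a : Fin (r + 1) → Fin 4) :
    extD q (partialSeries q) w (e q a) = wave q (fun n => c (n + 1) * sqInt q (n + 1))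
      (∑ b, antisym q (r + 1) b a • (pLow q (b 0) * W (Fin.tail b))) := by
  simp only [extD, ofTensor_e, h, lower_wave, map_sum, map_smul]

/-- The antisymmetriser on one index is the identity matrix, as testing `antisym_one` on `Pi.single
b 1` shows. Hence the components of a 1-form can be prescribed freely. -/
theorem planeWave_form {q : ℝ} (hq : q ≠ 0) (v : Fin 1 → Fin 4) :
    ofTensor q (fun b : Fin 1 → Fin 4 => planeWave q (b 0)) (e q v) = planeWave q (v 0) := by
  have h : ∀ b, antisym q 1 b v = if b = v then 1 else 0 := fun b => by
    have h := antisym_one hq (Pi.single b 1) v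
    simpa [Pi.single_apply, eq_comm] using h
  simp [ofTensor_e, h]

theorem exists_planeWave_form (q : ℝ) [NeZero q] :
    ∃ A : QForm q (Series q) 1, (∀ z : Fin 4, A (e q ![z]) = planeWave q z) ∧
      coD q (partialSeries q) (extD q (partialSeries q) A) = 0 ∧
      coD q (partialSeries q) A = 0 := by
  have hq0 : q ≠ 0 := NeZero.ne q
  let A : QForm q (Series q) 1 := ofTensor q fun b => planeWave q (b 0)
  have hA : ∀ v, A (e q v) = wave q _ (amp q (v 0)) := fun v =>
    (planeWave_form hq0 v).trans (planeWave_eq_wave q (v 0))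
  refine ⟨A, fun z => planeWave_form hq0 ![z], ?_, ?_⟩
  · have h : extD q (partialSeries q) (hodge q (extD q (partialSeries q) A)) = 0 := by
      refine QForm.eq_zero fun a => ?_
      rw [extD_wave (hodge_wave (extD_wave hA))]
      refine (congrArg _ (maxwell_amplitude hq0 _ a)).trans (map_zero _)
    exact (congrArg (hodge q) h).trans hodge_zero
  · have h : extD q (partialSeries q) (hodge q A) = 0 := by
      refine QForm.eq_zero fun a => ?_
      rw [extD_wave (hodge_wave hA)]
      refine (congrArg _ (lorentz_amplitude hq0 _ a)).trans (map_zero _)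
    exact (congrArg (hodge q) h).trans hodge_zero

end QMinkowski

end

theorem mainTheorem11 (q : ℝ) [NeZero q] (hq : q ≠ -1) :
    ∃ A : QMinkowski.QForm q (QMinkowski.Series q) 1,
      (∀ z : Fin 4, A (QMinkowski.e q ![z]) = QMinkowski.planeWave q z) ∧
      QMinkowski.coD q (QMinkowski.partialSeries q)
        (QMinkowski.extD q (QMinkowski.partialSeries q) A) = 0 ∧
      QMinkowski.coD q (QMinkowski.partialSeries q) A = 0 := by
  exact QMinkowski.exists_planeWave_form q
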